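/- Let $(W,S)$, $S=\{s_0,s_1,s_2\}$, be an affine Coxeter system of rank two, i.e. a Coxeter system with three generators such that $W$ is infinite and has a normal abelian subgroup of finite index. Let $\ell$ be the length function and $\le$ the Bruhat order. The elements of $W$ are identified with the alcoves of the Coxeter complex, whose nonempty simplices are the cosets $xW_J$ with $J\subsetneq S$; the alcoves $x$ and $xs_j$ are called neighbours. For a reflection $r\in W$ (a conjugate of some $s_j$), the wall $H_r$ is the set of simplices fixed by $r$ under left multiplication; its two sides are $\{x\in W\mid \ell(x)<\ell(rx)\}$ and $\{x\in W\mid \ell(rx)<\ell(x)\}$. Two distinct walls are parallel if they have no simplex in common, and two parallel walls are adjacent if no wall parallel to both lies between them. The annex of $w\in W$ is the set $\{y\in W\mid w\not\le y\}$ (equivalently, the set of $y$ whose trivial shadow does not contain $w$). An alcove $y$ lies on the boundary of a set $X$ of alcoves if $y\in X$ and some neighbour $ys_j$ of $y$ is not in $X$. Let $n\ge 2$, let $r_0,r_1,\dots,r_n\in W$ be reflections, and let $w\in W$ and $i\in\{0,1,2\}$. Suppose that property $(\dagger)$ holds for $((r_1,\dots,r_n),w,s_i)$, that is: (1) the walls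 $H_{r_0},H_{r_1},\dots,H_{r_n}$ are distinct and pairwise parallel, and $H_{r_{t-1}}$ and $H_{r_t}$ are adjacent for all $1\le t\le n$ (so $H_{r_0}$ is the wall adjacent to $H_{r_1}$ other than $H_{r_2}$); (2) the alcove $w$ lies between $H_{r_0}$ and $H_{r_1}$; (3) $\ell(ws_i)<\ell(w)$, and for all $1\le t\le n$ $$\ell(r_t\cdots r_1ws_i)=\ell(r_{t-1}\cdots r_1ws_i)+1\qquad\text{and}\qquad r_t\cdots r_1ws_i\ne r_{t-1}\cdots r_1w .$$ Then $r_n\cdots r_1ws_i$ lies on the boundary of the annex of $w$. -/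

import Mathlib

open scoped Pointwise

namespace CoxeterAnnex

/-- An affine Coxeter group: an infinite (Coxeter) group having a normal abelian subgroup
with finite quotient. -/
def IsAffine (W : Type*) [Group W] : Prop :=
  Infinite W ∧ ∃ A : Subgroup W, A.Normal ∧ (∀ a ∈ A, ∀ b ∈ A, a * b = b * a) ∧ A.FiniteIndex

/-- The standard parabolic subgroup `W_J` generated by the simple reflections indexed by `J`. -/
def parabolic {B W : Type*} [Group W] {M : CoxeterMatrix B} (cs : CoxeterSystem M W)
    (J : Set B) : Subgroup W :=
  Subgroup.closure (cs.simple '' J)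

/-- The (nonempty) simplices of the Coxeter complex: the cosets `x W_J` with `J` a proper subset
of the index set. The alcoves are the cosets with `J = ∅`, i.e. the elements of `W`. -/
def simplices {B W : Type*} [Group W] {M : CoxeterMatrix B} (cs : CoxeterSystem M W) :
    Set (Set W) :=
  {σ | ∃ (x : W) (J : Set B), J ≠ Set.univ ∧ σ = x • (parabolic cs J : Set W)}

/-- The wall `H_r`: the set of simplices of the Coxeter complex fixed by `r` acting on the left. -/
def wall {B W : Type*} [Group W] {M : CoxeterMatrix B} (cs : CoxeterSystem M W) (r : W) :
    Set (Set W) :=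
  {σ | σ ∈ simplices cs ∧ r • σ = σ}

/-- The walls of `r` and `r'` are (distinct and) parallel: they have no simplex in common. -/
def Parallel {B W : Type*} [Group W] {M : CoxeterMatrix B} (cs : CoxeterSystem M W)
    (r r' : W) : Prop :=
  Disjoint (wall cs r) (wall cs r')

/-- The half-space of `H_r` containing the identity alcove. -/
def identityHalf {B W : Type*} [Group W] {M : CoxeterMatrix B} (cs : CoxeterSystem M W)
    (r : W) : Set W :=
  {x | cs.length x < cs.length (r * x)}

/-- The alcoves `x` and `y` lie on the same side of `H_r`. -/
def SameSide {B W : Type*} [Group W] {M : CoxeterMatrix B} (cs : CoxeterSystem M W)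
    (r x y : W) : Prop :=
  x ∈ identityHalf cs r ↔ y ∈ identityHalf cs r

/-- The alcove `x` has a panel lying in `H_r`: the reflection `r` interchanges `x` with one of its
neighbours `x s_i`. -/
def Borders {B W : Type*} [Group W] {M : CoxeterMatrix B} (cs : CoxeterSystem M W)
    (r x : W) : Prop :=
  ∃ i : B, r * x = x * cs.simple i

/-- For parallel walls: the alcove `x` lies on that side of `H_r` on which the wall `H_q` lies,
i.e. on the side of all the alcoves along `H_q`. -/
def OnSideOf {B W : Type*} [Group W] {M : CoxeterMatrix B} (cs : CoxeterSystem M W)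
    (r q x : W) : Prop :=
  ∀ y : W, Borders cs q y → SameSide cs r x y

/-- The alcove `x` lies in the strip between the parallel walls `H_r` and `H_{r'}`. -/
def Between {B W : Type*} [Group W] {M : CoxeterMatrix B} (cs : CoxeterSystem M W)
    (r r' x : W) : Prop :=
  OnSideOf cs r r' x ∧ OnSideOf cs r' r x

/-- For pairwise parallel walls: `H_q` lies between `H_r` and `H_{r'}`, i.e. these two are on
opposite sides of `H_q`. -/
def Separates {B W : Type*} [Group W] {M : CoxeterMatrix B} (cs : CoxeterSystem M W)
    (q r r' : W) : Prop :=
  ∀ y y' : W, Borders cs r y → Borders cs r' y' → ¬ SameSide cs q y y'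

/-- The walls `H_r` and `H_{r'}` are parallel and adjacent: no wall parallel to them lies
between them. -/
def Adjacent {B W : Type*} [Group W] {M : CoxeterMatrix B} (cs : CoxeterSystem M W)
    (r r' : W) : Prop :=
  Parallel cs r r' ∧
    ∀ q : W, cs.IsReflection q → Parallel cs q r → Parallel cs q r' → ¬ Separates cs q r r'

/-- Bruhat order `x ≤ y`: every reduced expression of `y` has a subword that is a reduced
expression of `x`. -/
def BruhatLE {B W : Type*} [Group W] {M : CoxeterMatrix B} (cs : CoxeterSystem M W)
    (x y : W) : Prop :=
  ∀ ω : List B, cs.IsReduced ω → cs.wordProd ω = y →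
    ∃ ω' : List B, List.Sublist ω' ω ∧ cs.IsReduced ω' ∧ cs.wordProd ω' = x

/-- The annex of `x`: all alcoves `y` with `x ≰ y`. -/
def annex {B W : Type*} [Group W] {M : CoxeterMatrix B} (cs : CoxeterSystem M W)
    (x : W) : Set W :=
  {y | ¬ BruhatLE cs x y}

/-- The alcoves on the boundary of a set `X` of alcoves: those in `X` having a neighbouring alcove
(one sharing a panel) outside `X`. -/
def boundary {B W : Type*} [Group W] {M : CoxeterMatrix B} (cs : CoxeterSystem M W)
    (X : Set W) : Set W :=
  {y | y ∈ X ∧ ∃ j : B, y * cs.simple j ∉ X}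

/-- The product `r_t ⋯ r_1` (so `1` for `t = 0`; the entry `r 0` does not occur). -/
def reflProd {W : Type*} [Group W] (r : ℕ → W) : ℕ → W
  | 0 => 1
  | t + 1 => r (t + 1) * reflProd r t

/-- Property (†) for `((r_1, …, r_n), w, s_i)`. The sequence `r` also records `r_0 = r 0`, which is
the reflection in the wall adjacent to `H_{r_1}` other than `H_{r_2}`; entries beyond `n` are
irrelevant. -/
structure PropertyDagger {B W : Type*} [Group W] {M : CoxeterMatrix B} (cs : CoxeterSystem M W)
    (n : ℕ) (r : ℕ → W) (w : W) (i : B) : Prop where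
  two_le : 2 ≤ n
  isReflection : ∀ t ≤ n, cs.IsReflection (r t)
  parallel : ∀ s t, s < t → t ≤ n → Parallel cs (r s) (r t)
  adjacent : ∀ t < n, Adjacent cs (r t) (r (t + 1))
  between : Between cs (r 0) (r 1) w
  descent : cs.length (w * cs.simple i) < cs.length w
  length_step : ∀ t, 1 ≤ t → t ≤ n →
    cs.length (reflProd r t * w * cs.simple i) =
      cs.length (reflProd r (t - 1) * w * cs.simple i) + 1
  ne_step : ∀ t, 1 ≤ t → t ≤ n →
    reflProd r t * w * cs.simple i ≠ reflProd r (t - 1) * w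

end CoxeterAnnex

set_option linter.unusedSectionVars false

open scoped Pointwise

namespace CoxeterAnnex

/-! ### Reduced factorizations along a dihedral parabolic subgroup -/

section Words

variable {B W : Type*} [Group W] {M : CoxeterMatrix B} (cs : CoxeterSystem M W)

/-! Put `u = w s_i`, `y = r_n ⋯ r_1 u`, and let `D` be the group generated by `r_1, …, r_n`. The
length condition in (†) says that `u, r_1 u, …, y` is a saturated Bruhat chain inside the coset `D
u`. The inequality condition keeps `i` an ascent at every stage, so multiplying the chain by `s_i`
on the right gives a saturated chain from `w` to `y s_i`. Hence `w ≤ y s_i`, and the neighbour `y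
s_i` is outside the annex.

It remains to exclude `w ≤ y`. If it held, `w` would lie in the interval from `u` to `y`. An
interval whose ends are joined by a saturated chain in `D u` lies entirely in `D u`
(`mul_inv_mem_of_interval`), so the reflection `w s_i w⁻¹ = w u⁻¹` would belong to `D`. Everything
after `PropertyDagger.mem_boundary` serves to refute this.

In the geometric representation of an affine group of rank three, parallel walls have roots that
agree, up to sign, modulo the radical of the form (`exists_isRootOf_sub_mem_radical`). The abelian
subgroup enters only here: a power of the product of the two reflections commutes with its
conjugates. Consequently a root `c` of `w s_i w⁻¹ ∈ D` is also congruent to the root of `r_1`. Roots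
of one class are totally ordered, which is the order of the parallel walls across the plane.

The wall of `c` borders `w`, and `w` lies in the strip between the adjacent walls `H_{r_0}` and
`H_{r_1}`; so it is one of these two. If it is `H_{r_1}`, then `r_1 w s_i = w`, which (†) forbids.
If it is `H_{r_0}`, then the identity and `u` both lie beyond `H_{r_0}`, so `r_1 u` lies beyond the
mirror image of `H_{r_0}` in `H_{r_1}`. By adjacency `H_{r_2}` is no farther than that image, so
`r_2` shortens `r_1 u`, contradicting the length condition for `t = 2`. -/

lemma exists_reduced_alternating_suffix (w : W) {i j : B}
    (hj : cs.length (w * cs.simple j) < cs.length w) :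
    ∃ k, 0 < k ∧ ∃ v, w = v * cs.wordProd (CoxeterSystem.alternatingWord i j k) ∧
      cs.length w = cs.length v + k ∧ cs.length v < cs.length (v * cs.simple i) ∧
      cs.length v < cs.length (v * cs.simple j) := by
  induction hn : cs.length w using Nat.strong_induction_on generalizing w i j with
  | _ n ih =>
    subst hn
    -- Peel off the final letter `j`. If `i` is then a descent, recurse with the letters exchanged;
    -- otherwise stop with `k = 1`.
    have hlt := (cs.isRightDescent_iff).1 hj
    by_cases hi : cs.length (w * cs.simple j * cs.simple i) < cs.length (w * cs.simple j)
    · obtain ⟨k, hk, v, hv, hl, h1, h2⟩ := ih _ hj (w * cs.simple j) (i := j) (j := i) hi rfl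
      refine ⟨k + 1, by omega, v, ?_, by omega, h2, h1⟩
      rw [CoxeterSystem.alternatingWord_succ, cs.wordProd_concat, ← mul_assoc, ← hv,
        cs.simple_mul_simple_cancel_right]
    · refine ⟨1, one_pos, w * cs.simple j, by simp [CoxeterSystem.alternatingWord], by omega, ?_, ?_⟩
      · have := cs.length_mul_simple_ne (w * cs.simple j) i
        omega
      · simpa using hj

end Words

/-! ### The geometric representation and positivity of roots -/

section GeometricRepresentation

variable {B W : Type*} [Group W] [Fintype B] [DecidableEq B] {M : CoxeterMatrix B}

/-- The standard bilinear form attached to a Coxeter matrix. -/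
noncomputable def form (M : CoxeterMatrix B) : LinearMap.BilinForm ℝ (B → ℝ) :=
  -- An infinite order is encoded as `M i j = 0`; then `π / 0 = 0` and the entry is `-1`, the usual
  -- convention.
  Matrix.toBilin' (Matrix.of fun i j => -Real.cos (Real.pi / M i j))

/-- The simple root indexed by `i`. -/
def simpleRoot (i : B) : B → ℝ := Pi.single i 1

lemma form_simpleRoot (M : CoxeterMatrix B) (i j : B) :
    form M (simpleRoot i) (simpleRoot j) = -Real.cos (Real.pi / M i j) := by
  simp [form, simpleRoot, Matrix.toBilin'_single]

lemma form_simpleRoot_self (M : CoxeterMatrix B) (i : B) :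
    form M (simpleRoot i) (simpleRoot i) = 1 := by
  simp [form_simpleRoot]

lemma form_comm (M : CoxeterMatrix B) (v w : B → ℝ) : form M v w = form M w v := by
  simp only [form, Matrix.toBilin'_apply, Matrix.of_apply]
  rw [Finset.sum_comm]
  refine Finset.sum_congr rfl fun i _ => Finset.sum_congr rfl fun j _ => ?_
  rw [M.symmetric j i]
  ring

lemma eq_sum_simpleRoot (v : B → ℝ) : v = ∑ i, v i • simpleRoot i := by
  simpa [simpleRoot, ← Pi.single_smul] using (Finset.univ_sum_single v).symm

lemma form_simpleRoot_nonpos (M : CoxeterMatrix B) {i j : B} (h : i ≠ j) :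
    form M (simpleRoot i) (simpleRoot j) ≤ 0 := by
  rw [form_simpleRoot, neg_nonpos]
  have hm := M.off_diagonal i j h
  rcases Nat.eq_zero_or_pos (M i j) with h0 | h0
  · simp [h0]
  have h2 : (2 : ℝ) ≤ M i j := by exact_mod_cast (by omega : 2 ≤ M i j)
  apply Real.cos_nonneg_of_neg_pi_div_two_le_of_le
  · have : 0 ≤ Real.pi / M i j := by positivity
    linarith [Real.pi_pos]
  · exact div_le_div_of_nonneg_left Real.pi_pos.le (by norm_num) h2

/-- The reflection of `B → ℝ` in the vector `b` (with respect to the standard form; of interest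
for unit vectors). -/
noncomputable def reflect (M : CoxeterMatrix B) (b : B → ℝ) : Module.End ℝ (B → ℝ) :=
  LinearMap.id - ((2 : ℝ) • (form M).flip b).smulRight b

lemma reflect_apply (M : CoxeterMatrix B) (b v : B → ℝ) :
    reflect M b v = v - (2 * form M v b) • b := by
  simp [reflect]

lemma reflect_self (M : CoxeterMatrix B) {b : B → ℝ} (hb : form M b b = 1) :
    reflect M b b = -b := by
  rw [reflect_apply, hb]; module

lemma form_reflect (M : CoxeterMatrix B) {b : B → ℝ} (hb : form M b b = 1) (v w : B → ℝ) :
    form M (reflect M b v) (reflect M b w) = form M v w := by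
  simp only [reflect_apply, map_sub, map_smul, LinearMap.sub_apply, LinearMap.smul_apply,
    smul_eq_mul, hb, form_comm M b w]
  ring

lemma reflect_reflect (M : CoxeterMatrix B) {b : B → ℝ} (hb : form M b b = 1) (v : B → ℝ) :
    reflect M b (reflect M b v) = v := by
  rw [reflect_apply M b (reflect M b v), reflect_apply]
  simp only [map_sub, map_smul, LinearMap.sub_apply, LinearMap.smul_apply, smul_eq_mul, hb]
  module

/-- The coefficients `sin (k π / m) / sin (π / m)` (`k` if `m = ∞`) of the roots of a dihedral
group. -/
noncomputable def dihedralCoeff (m k : ℕ) : ℝ :=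
  if m = 0 then k else Real.sin (k * (Real.pi / m)) / Real.sin (Real.pi / m)

lemma sin_pi_div_pos {m : ℕ} (hm : 2 ≤ m) : 0 < Real.sin (Real.pi / m) := by
  have h2 : (2 : ℝ) ≤ m := by exact_mod_cast hm
  apply Real.sin_pos_of_pos_of_lt_pi
  · have := Real.pi_pos
    positivity
  · rw [div_lt_iff₀ (by linarith)]
    nlinarith [Real.pi_pos]

lemma dihedralCoeff_zero (m : ℕ) : dihedralCoeff m 0 = 0 := by simp [dihedralCoeff]

lemma dihedralCoeff_one {m : ℕ} (hm : m ≠ 1) : dihedralCoeff m 1 = 1 := by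
  unfold dihedralCoeff
  split_ifs with h
  · simp
  · have := sin_pi_div_pos (show 2 ≤ m by omega)
    simp [this.ne']

/-- Addition formula for the sine. For `m = 0` the cosine is `cos 0 = 1`, and the recursion is that
of an arithmetic progression. -/
lemma dihedralCoeff_add_two {m : ℕ} (k : ℕ) :
    dihedralCoeff m (k + 2) =
      2 * Real.cos (Real.pi / m) * dihedralCoeff m (k + 1) - dihedralCoeff m k := by
  unfold dihedralCoeff
  split_ifs with h
  · subst h; simp; ring
  · have e1 : ((k + 2 : ℕ) : ℝ) * (Real.pi / m) = ((k + 1 : ℕ) : ℝ) * (Real.pi / m) + Real.pi / m := by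
      push_cast; ring
    have e2 : (k : ℝ) * (Real.pi / m) = ((k + 1 : ℕ) : ℝ) * (Real.pi / m) - Real.pi / m := by
      push_cast; ring
    rw [e1, e2, Real.sin_add, Real.sin_sub]
    ring

lemma dihedralCoeff_nonneg {m k : ℕ} (hm : m ≠ 1) (h : m ≠ 0 → k ≤ m) :
    0 ≤ dihedralCoeff m k := by
  unfold dihedralCoeff
  split_ifs with h0
  · positivity
  · refine div_nonneg (Real.sin_nonneg_of_nonneg_of_le_pi ?_ ?_)
      (sin_pi_div_pos (by omega)).le
    · have := Real.pi_pos
      positivity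
    · have hk : (k : ℝ) ≤ m := by exact_mod_cast h h0
      have hm : (0 : ℝ) < m := by exact_mod_cast Nat.pos_of_ne_zero h0
      rw [mul_div_assoc', div_le_iff₀ hm]
      nlinarith [Real.pi_pos]

lemma reflect_simpleRoot_combination (M : CoxeterMatrix B) (i j : B) (k : ℕ) :
    reflect M (simpleRoot j) (dihedralCoeff (M i j) (k + 1) • simpleRoot i +
        dihedralCoeff (M i j) k • simpleRoot j) =
      dihedralCoeff (M i j) (k + 2) • simpleRoot j +
        dihedralCoeff (M i j) (k + 1) • simpleRoot i := by
  rw [dihedralCoeff_add_two, reflect_apply]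
  simp only [map_add, map_smul, LinearMap.add_apply, LinearMap.smul_apply, smul_eq_mul,
    form_simpleRoot_self, form_simpleRoot]
  module

lemma pow_reflect_mul_reflect_simpleRoot (M : CoxeterMatrix B) {i j : B} (hij : i ≠ j) (k : ℕ) :
    ((reflect M (simpleRoot i) * reflect M (simpleRoot j)) ^ k) (simpleRoot i) =
      dihedralCoeff (M i j) (2 * k + 1) • simpleRoot i +
        dihedralCoeff (M i j) (2 * k) • simpleRoot j := by
  induction k with
  | zero => simp [dihedralCoeff_zero, dihedralCoeff_one (M.off_diagonal i j hij)]
  | succ k ih =>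
    have h := reflect_simpleRoot_combination M j i (2 * k + 1)
    rw [M.symmetric j i] at h
    rw [pow_succ', Module.End.mul_apply, ih, Module.End.mul_apply,
      reflect_simpleRoot_combination, h]
    rfl

lemma dihedralCoeff_two_mul {m : ℕ} (hm : m ≠ 0) : dihedralCoeff m (2 * m) = 0 := by
  have : (m : ℝ) ≠ 0 := by exact_mod_cast hm
  have e : ((2 * m : ℕ) : ℝ) * (Real.pi / m) = 2 * Real.pi := by push_cast; field_simp
  rw [dihedralCoeff, if_neg hm, e, Real.sin_two_pi, zero_div]

lemma dihedralCoeff_two_mul_add_one {m : ℕ} (hm : 2 ≤ m) : dihedralCoeff m (2 * m + 1) = 1 := by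
  have : (m : ℝ) ≠ 0 := by exact_mod_cast (by omega : m ≠ 0)
  have e : ((2 * m + 1 : ℕ) : ℝ) * (Real.pi / m) = Real.pi / m + 2 * Real.pi := by
    push_cast; field_simp; ring
  rw [dihedralCoeff, if_neg (by omega), e, Real.sin_add_two_pi]
  exact div_self (sin_pi_div_pos hm).ne'

/-- A vector is the sum of a combination of two unit vectors spanning a nondegenerate plane and of
a vector orthogonal to both. -/
lemma exists_orthogonal_decomposition (M : CoxeterMatrix B) {a b : B → ℝ} (ha : form M a a = 1)
    (hb : form M b b = 1) (hab : form M a b ^ 2 ≠ 1) (v : B → ℝ) :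
    ∃ (x y : ℝ) (l : B → ℝ), v = x • a + y • b + l ∧ form M l a = 0 ∧ form M l b = 0 := by
  set c := form M a b with hc
  have hd : 1 - c ^ 2 ≠ 0 := fun h => hab (by linarith)
  have hba : form M b a = c := form_comm M b a
  refine ⟨(form M v a - c * form M v b) / (1 - c ^ 2), (form M v b - c * form M v a) / (1 - c ^ 2),
    _, (add_sub_cancel _ v).symm, ?_, ?_⟩
  · simp only [map_sub, map_add, map_smul, LinearMap.sub_apply, LinearMap.add_apply,
      LinearMap.smul_apply, smul_eq_mul, ha, hba]
    field_simp
    ring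
  · simp only [map_sub, map_add, map_smul, LinearMap.sub_apply, LinearMap.add_apply,
      LinearMap.smul_apply, smul_eq_mul, hb, ← hc]
    field_simp
    ring

lemma pow_apply_eq_self {V : Type*} [AddCommGroup V] [Module ℝ V] (f : Module.End ℝ V) {v : V}
    (h : f v = v) (k : ℕ) : (f ^ k) v = v := by
  induction k with
  | zero => simp
  | succ k ih => rw [pow_succ, Module.End.mul_apply, h, ih]

/-- For finite `m` the plane of two simple roots is nondegenerate and its orthogonal space is fixed.
In the plane, the coefficients at `2m` and `2m + 1` are `0` and `1`, so the `m`-th power fixes one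
simple root; the other one follows by passing to the inverse. -/
lemma isLiftable_reflect (M : CoxeterMatrix B) :
    M.IsLiftable fun i => reflect M (simpleRoot i) := by
  have inv : ∀ i, reflect M (simpleRoot i) * reflect M (simpleRoot i) = 1 := fun i =>
    LinearMap.ext fun v => reflect_reflect M (form_simpleRoot_self M i) v
  have inv2 : ∀ i j k, (reflect M (simpleRoot i) * reflect M (simpleRoot j)) ^ k *
      (reflect M (simpleRoot j) * reflect M (simpleRoot i)) ^ k = 1 := by
    intro i j k
    induction k with
    | zero => simp
    | succ k ih =>
      rw [pow_succ, pow_succ']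
      calc _ = (reflect M (simpleRoot i) * reflect M (simpleRoot j)) ^ k *
              (reflect M (simpleRoot i) * (reflect M (simpleRoot j) * reflect M (simpleRoot j)) *
                reflect M (simpleRoot i)) *
              (reflect M (simpleRoot j) * reflect M (simpleRoot i)) ^ k := by
              simp only [mul_assoc]
        _ = 1 := by rw [inv, mul_one, inv, mul_one, ih]
  intro i j
  by_cases hij : i = j
  · subst hij; simp [inv]
  rcases Nat.eq_zero_or_pos (M i j) with h0 | h0
  · simp [h0]
  have hm : 2 ≤ M i j := by have := M.off_diagonal i j hij; omega
  have key : ∀ i j, i ≠ j → 2 ≤ M i j →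
      ((reflect M (simpleRoot i) * reflect M (simpleRoot j)) ^ M i j) (simpleRoot i) =
        simpleRoot i := by
    intro i j hij hm
    rw [pow_reflect_mul_reflect_simpleRoot M hij, dihedralCoeff_two_mul (by omega),
      dihedralCoeff_two_mul_add_one hm]
    simp
  have hi := key i j hij hm
  have hj : ((reflect M (simpleRoot i) * reflect M (simpleRoot j)) ^ M i j) (simpleRoot j) =
      simpleRoot j := by
    have h := key j i (Ne.symm hij) (by rwa [M.symmetric j i])
    rw [M.symmetric j i] at h
    have h' := congrArg (fun f => f (simpleRoot j)) (inv2 i j (M i j))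
    simpa [Module.End.mul_apply, h] using h'
  refine LinearMap.ext fun v => ?_
  obtain ⟨x, y, l, rfl, hla, hlb⟩ := exists_orthogonal_decomposition M (form_simpleRoot_self M i)
    (form_simpleRoot_self M j) (by
      rw [form_simpleRoot]
      have h1 := sin_pi_div_pos hm
      have h2 := Real.sin_sq_add_cos_sq (Real.pi / M i j)
      intro h
      nlinarith) v
  have hl : ((reflect M (simpleRoot i) * reflect M (simpleRoot j)) ^ M i j) l = l :=
    pow_apply_eq_self _ (by simp [Module.End.mul_apply, reflect_apply, hla, hlb]) _
  simp only [map_add, map_smul, hi, hj, hl, Module.End.one_apply]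

/-- The geometric representation of a Coxeter group. -/
noncomputable def geomRep (cs : CoxeterSystem M W) : W →* Module.End ℝ (B → ℝ) :=
  cs.lift ⟨fun i => reflect M (simpleRoot i), isLiftable_reflect M⟩

variable (cs : CoxeterSystem M W)

lemma geomRep_simple (i : B) : geomRep cs (cs.simple i) = reflect M (simpleRoot i) :=
  cs.lift_apply_simple (isLiftable_reflect M) i

lemma geomRep_mul_apply (x y : W) (v : B → ℝ) :
    geomRep cs (x * y) v = geomRep cs x (geomRep cs y v) := by
  rw [map_mul, Module.End.mul_apply]

@[simp] lemma geomRep_inv_apply_self (x : W) (v : B → ℝ) :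
    geomRep cs x⁻¹ (geomRep cs x v) = v := by
  rw [← geomRep_mul_apply]; simp

@[simp] lemma geomRep_apply_inv_self (x : W) (v : B → ℝ) :
    geomRep cs x (geomRep cs x⁻¹ v) = v := by
  rw [← geomRep_mul_apply]; simp

lemma form_geomRep (x : W) (v w : B → ℝ) :
    form M (geomRep cs x v) (geomRep cs x w) = form M v w := by
  induction x using cs.simple_induction_left with
  | one => simp
  | mul_simple_left x i ih =>
    rw [geomRep_mul_apply, geomRep_mul_apply, geomRep_simple,
      form_reflect M (form_simpleRoot_self M i), ih]

lemma geomRep_simple_self (i : B) :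
    geomRep cs (cs.simple i) (simpleRoot i) = -simpleRoot i := by
  rw [geomRep_simple, reflect_self M (form_simpleRoot_self M i)]

/-- Each letter shifts the index of the coefficients by one and exchanges the two roots. The offset
`p` is there for the induction; `p = 0` gives the image of a simple root. -/
lemma geomRep_alternatingWord {i j : B} (hij : i ≠ j) (k p : ℕ) :
    ∃ a b : B, (a = i ∧ b = j ∨ a = j ∧ b = i) ∧
      geomRep cs (cs.wordProd (CoxeterSystem.alternatingWord i j k))
        (dihedralCoeff (M i j) (p + 1) • simpleRoot i + dihedralCoeff (M i j) p • simpleRoot j) =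
      dihedralCoeff (M i j) (p + k + 1) • simpleRoot a +
        dihedralCoeff (M i j) (p + k) • simpleRoot b := by
  induction k generalizing i j p with
  | zero => exact ⟨i, j, by simp [CoxeterSystem.alternatingWord]⟩
  | succ k ih =>
    obtain ⟨a, b, hab, h⟩ := ih hij.symm (p + 1)
    refine ⟨a, b, by tauto, ?_⟩
    rw [CoxeterSystem.alternatingWord_succ, cs.wordProd_concat, geomRep_mul_apply,
      geomRep_simple, reflect_simpleRoot_combination]
    rw [M.symmetric j i] at h
    rw [h]
    congr 3 <;> omega

lemma simpleRoot_nonneg (i : B) : (0 : B → ℝ) ≤ simpleRoot i := by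
  simp [simpleRoot]

/-- The fundamental positivity theorem. -/
theorem geomRep_simpleRoot_nonneg (w : W) (i : B)
    (h : cs.length w < cs.length (w * cs.simple i)) : 0 ≤ geomRep cs w (simpleRoot i) := by
  induction hn : cs.length w using Nat.strong_induction_on generalizing w i with
  | _ n ih =>
    subst hn
    by_cases hw : w = 1
    · subst hw; simpa using simpleRoot_nonneg i
    obtain ⟨j, hj⟩ := cs.exists_rightDescent_of_ne_one hw
    have hij : i ≠ j := by
      rintro rfl
      exact absurd h (not_lt.2 (le_of_lt hj))
    obtain ⟨k, hk, v, hv, hl, h1, h2⟩ := exists_reduced_alternating_suffix cs w (i := i) hj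
    have hi' := ih _ (by omega) v i h1 rfl
    have hj' := ih _ (by omega) v j h2 rfl
    -- If `k ≥ m`, reducedness gives `k = m`. The braid relation then rewrites the alternating
    -- suffix of `w s_i`, of length `m + 1`, with only `m - 1` letters, so `i` would be a descent of
    -- `w`.
    have hkm : M i j ≠ 0 → k + 1 ≤ M i j := by
      intro h0
      by_contra! hcon
      have hk2 : k ≤ M i j := by
        by_contra! hlt
        have h3 := cs.length_wordProd_le (CoxeterSystem.alternatingWord i j k)
        have h4 := cs.length_mul_le v (cs.wordProd (CoxeterSystem.alternatingWord i j k))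
        rw [CoxeterSystem.length_alternatingWord] at h3
        rw [← hv] at h4
        refine cs.not_isReduced_alternatingWord i j h0 hlt ?_
        rw [CoxeterSystem.IsReduced, CoxeterSystem.length_alternatingWord]
        omega
      have hM : 2 ≤ M i j := by have := M.off_diagonal i j hij; omega
      have he : w * cs.simple i = v * cs.wordProd
          (CoxeterSystem.alternatingWord i j (M i j * 2 - (k + 1))) := by
        have h3 := cs.prod_alternatingWord_eq_prod_alternatingWord_sub j i (k + 1)
          (by rw [M.symmetric j i]; omega)
        rw [M.symmetric j i, CoxeterSystem.alternatingWord_succ, cs.wordProd_concat] at h3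
        rw [← h3, ← mul_assoc, ← hv]
      have h3 := cs.length_wordProd_le
        (CoxeterSystem.alternatingWord i j (M i j * 2 - (k + 1)))
      have h4 := cs.length_mul_le v (cs.wordProd
        (CoxeterSystem.alternatingWord i j (M i j * 2 - (k + 1))))
      rw [CoxeterSystem.length_alternatingWord] at h3
      rw [← he] at h4
      omega
    obtain ⟨a, b, hab, he⟩ := geomRep_alternatingWord cs hij k 0
    rw [dihedralCoeff_one (M.off_diagonal i j hij), dihedralCoeff_zero] at he
    simp only [zero_add, one_smul, zero_smul, add_zero] at he
    have hm1 := M.off_diagonal i j hij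
    rw [hv, geomRep_mul_apply, he, map_add, map_smul, map_smul]
    have c1 := dihedralCoeff_nonneg hm1 hkm
    have c2 : 0 ≤ dihedralCoeff (M i j) k := dihedralCoeff_nonneg hm1 fun h => by
      have := hkm h; omega
    rcases hab with ⟨rfl, rfl⟩ | ⟨rfl, rfl⟩ <;>
      exact add_nonneg (smul_nonneg c1 ‹_›) (smul_nonneg c2 ‹_›)

lemma geomRep_simpleRoot_nonpos (w : W) (i : B)
    (h : cs.length (w * cs.simple i) < cs.length w) : geomRep cs w (simpleRoot i) ≤ 0 := by
  have h' := geomRep_simpleRoot_nonneg cs (w * cs.simple i) i (by simpa using h)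
  rw [geomRep_mul_apply, geomRep_simple_self, map_neg] at h'
  exact neg_nonneg.1 h'

lemma simpleRoot_ne_zero (M : CoxeterMatrix B) (i : B) : (simpleRoot i : B → ℝ) ≠ 0 := by
  intro h
  have := form_simpleRoot_self M i
  simp [h] at this

/-- The geometric representation is faithful. -/
theorem geomRep_injective : Function.Injective (geomRep cs) := by
  rw [injective_iff_map_eq_one]
  intro w hw
  by_contra hne
  obtain ⟨i, hi⟩ := cs.exists_rightDescent_of_ne_one hne
  have h := geomRep_simpleRoot_nonpos cs w i hi
  rw [hw, Module.End.one_apply] at h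
  exact simpleRoot_ne_zero M i (le_antisymm h (simpleRoot_nonneg i))

/-- The vector `b` is a root of the reflection `r`. -/
def IsRootOf (r : W) (b : B → ℝ) : Prop :=
  ∃ w i, r = w * cs.simple i * w⁻¹ ∧ b = geomRep cs w (simpleRoot i)

variable {cs}

lemma _root_.CoxeterSystem.IsReflection.exists_isRootOf {r : W} (hr : cs.IsReflection r) :
    ∃ b, IsRootOf cs r b := by
  obtain ⟨w, i, rfl⟩ := hr
  exact ⟨_, w, i, rfl, rfl⟩

lemma isRootOf_simple (i : B) : IsRootOf cs (cs.simple i) (simpleRoot i) :=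
  ⟨1, i, by simp, by simp⟩

/-! ### Roots of reflections, strong exchange and the length criterion -/

namespace IsRootOf

variable {r : W} {b : B → ℝ}

lemma isReflection (h : IsRootOf cs r b) : cs.IsReflection r := by
  obtain ⟨w, i, hr, -⟩ := h
  exact ⟨w, i, hr⟩

lemma conj (h : IsRootOf cs r b) (x : W) : IsRootOf cs (x * r * x⁻¹) (geomRep cs x b) := by
  obtain ⟨w, i, rfl, rfl⟩ := h
  exact ⟨x * w, i, by group, by rw [geomRep_mul_apply]⟩

lemma neg (h : IsRootOf cs r b) : IsRootOf cs r (-b) := by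
  obtain ⟨w, i, rfl, rfl⟩ := h
  refine ⟨w * cs.simple i, i, by simp [mul_assoc], ?_⟩
  rw [geomRep_mul_apply, geomRep_simple_self, map_neg]

lemma form_self (h : IsRootOf cs r b) : form M b b = 1 := by
  obtain ⟨w, i, rfl, rfl⟩ := h
  rw [form_geomRep, form_simpleRoot_self]

lemma ne_zero (h : IsRootOf cs r b) : b ≠ 0 := by
  rintro rfl
  simpa using h.form_self

lemma geomRep_eq (h : IsRootOf cs r b) : geomRep cs r = reflect M b := by
  obtain ⟨w, i, rfl, rfl⟩ := h
  refine LinearMap.ext fun v => ?_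
  rw [geomRep_mul_apply, geomRep_mul_apply, geomRep_simple, reflect_apply, reflect_apply, map_sub,
    map_smul, geomRep_apply_inv_self]
  congr 3
  rw [← form_geomRep cs w, geomRep_apply_inv_self]

lemma geomRep_apply (h : IsRootOf cs r b) (v : B → ℝ) :
    geomRep cs r v = v - (2 * form M v b) • b := by
  rw [h.geomRep_eq, reflect_apply]

lemma geomRep_self (h : IsRootOf cs r b) : geomRep cs r b = -b := by
  rw [h.geomRep_eq, reflect_self M h.form_self]

lemma unique {r' : W} (h : IsRootOf cs r b) (h' : IsRootOf cs r' b) : r = r' :=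
  geomRep_injective cs (by rw [h.geomRep_eq, h'.geomRep_eq])

lemma eq_or_eq_neg {b' : B → ℝ} (h : IsRootOf cs r b) (h' : IsRootOf cs r b') :
    b = b' ∨ b = -b' := by
  have h1 := h.geomRep_self
  rw [h'.geomRep_apply] at h1
  have h2 : b = form M b b' • b' := by
    have : (2 : ℝ) • b = (2 : ℝ) • (form M b b' • b') := by
      rw [two_smul]
      nth_rw 1 [← neg_neg b]
      rw [← h1]
      module
    exact smul_right_injective _ two_ne_zero this
  have h3 := h.form_self
  rw [h2] at h3
  simp only [map_smul, LinearMap.smul_apply, h'.form_self, smul_eq_mul, mul_one] at h3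
  rcases mul_self_eq_one_iff.1 h3 with h4 | h4
  · left; rw [h2, h4, one_smul]
  · right; rw [h2, h4, neg_one_smul]

lemma nonneg_or_nonpos (h : IsRootOf cs r b) : 0 ≤ b ∨ b ≤ 0 := by
  obtain ⟨w, i, -, rfl⟩ := h
  rcases lt_or_gt_of_ne (cs.length_mul_simple_ne w i) with h | h
  · exact Or.inr (geomRep_simpleRoot_nonpos cs w i h)
  · exact Or.inl (geomRep_simpleRoot_nonneg cs w i h)

lemma not_nonneg_and_nonpos (h : IsRootOf cs r b) (h1 : 0 ≤ b) (h2 : b ≤ 0) : False :=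
  h.ne_zero (le_antisymm h2 h1)

/-- The only positive root made negative by a simple reflection is the simple root. -/
lemma eq_simpleRoot (h : IsRootOf cs r b) (h0 : 0 ≤ b) {i : B}
    (hi : geomRep cs (cs.simple i) b ≤ 0) : b = simpleRoot i := by
  rw [geomRep_simple, reflect_apply] at hi
  -- A simple reflection changes only the `i`-th coordinate; all others are both nonnegative and
  -- nonpositive.
  have hb : b = b i • simpleRoot i := by
    ext j
    by_cases hj : j = i
    · subst hj; simp [simpleRoot]
    · have h1 := hi j
      have h2 := h0 j
      simp [simpleRoot, hj] at h1 h2 ⊢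
      linarith
  have h1 := h.form_self
  rw [hb] at h1
  simp only [map_smul, LinearMap.smul_apply, form_simpleRoot_self, smul_eq_mul, mul_one] at h1
  have h2 : b i = 1 := (mul_self_eq_one_iff.1 h1).resolve_right fun h3 => by
    have := h0 i
    simp [h3] at this
    linarith
  rw [hb, h2, one_smul]

/-- The strong exchange property. -/
theorem exists_eraseIdx (h : IsRootOf cs r b) (h0 : 0 ≤ b) (ω : List B)
    (hω : geomRep cs (cs.wordProd ω)⁻¹ b ≤ 0) :
    ∃ k < ω.length, r * cs.wordProd ω = cs.wordProd (ω.eraseIdx k) := by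
  induction ω generalizing r b with
  | nil => exact (h.not_nonneg_and_nonpos h0 (by simpa using hω)).elim
  | cons a ω ih =>
    have hconj := h.conj (cs.simple a)
    rw [cs.inv_simple] at hconj
    -- Strip letters from the front, carrying the root along. At the letter where it turns negative
    -- the root is the simple root of that letter, which therefore cancels.
    rcases hconj.nonneg_or_nonpos with h1 | h1
    · obtain ⟨k, hk, he⟩ := ih hconj h1 (by
        rwa [cs.wordProd_cons, mul_inv_rev, geomRep_mul_apply, cs.inv_simple] at hω)
      refine ⟨k + 1, by simpa using hk, ?_⟩
      rw [List.eraseIdx_cons_succ, cs.wordProd_cons, cs.wordProd_cons, ← he]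
      simp only [mul_assoc, cs.simple_mul_simple_cancel_left]
    · refine ⟨0, by simp, ?_⟩
      have hb := h.eq_simpleRoot h0 h1
      subst hb
      rw [h.unique (isRootOf_simple a)]
      simp [cs.wordProd_cons]

lemma length_mul_lt (h : IsRootOf cs r b) (h0 : 0 ≤ b) {x : W} (hx : geomRep cs x⁻¹ b ≤ 0) :
    cs.length (r * x) < cs.length x := by
  obtain ⟨ω, hω, rfl⟩ := cs.exists_isReduced x
  obtain ⟨k, hk, he⟩ := h.exists_eraseIdx h0 ω hx
  have h1 := cs.length_wordProd_le (ω.eraseIdx k)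
  rw [List.length_eraseIdx_of_lt hk] at h1
  rw [he, hω.eq]
  omega

lemma inv_mul (h : IsRootOf cs r b) (x : W) :
    geomRep cs (r * x)⁻¹ b = -geomRep cs x⁻¹ b := by
  rw [mul_inv_rev, h.isReflection.inv, geomRep_mul_apply, h.geomRep_self, map_neg]

lemma inv_conj (h : IsRootOf cs r b) (x : W) : IsRootOf cs (x⁻¹ * r * x) (geomRep cs x⁻¹ b) := by
  simpa using h.conj x⁻¹

lemma lt_length_mul (h : IsRootOf cs r b) (h0 : 0 ≤ b) {x : W} (hx : 0 ≤ geomRep cs x⁻¹ b) :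
    cs.length x < cs.length (r * x) := by
  have h1 := h.length_mul_lt h0 (x := r * x) (by rw [h.inv_mul]; exact neg_nonpos.2 hx)
  rwa [← mul_assoc, h.isReflection.mul_self, one_mul] at h1

/-- The length criterion for the sides of a wall. -/
lemma lt_length_mul_iff (h : IsRootOf cs r b) (h0 : 0 ≤ b) {x : W} :
    cs.length x < cs.length (r * x) ↔ 0 ≤ geomRep cs x⁻¹ b := by
  refine ⟨fun hlt => ?_, h.lt_length_mul h0⟩
  rcases (h.inv_conj x).nonneg_or_nonpos with h1 | h1
  · exact h1
  · exact absurd (h.length_mul_lt h0 h1) (not_lt.2 hlt.le)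

end IsRootOf

end GeometricRepresentation

/-! ### Chains in the Bruhat graph, lifting, and intervals in cosets -/

section BruhatChains

variable {B W : Type*} [Group W] [Fintype B] [DecidableEq B] {M : CoxeterMatrix B}

/-- An edge of the Bruhat graph. -/
def BruhatStep (cs : CoxeterSystem M W) (x y : W) : Prop :=
  ∃ r, cs.IsReflection r ∧ y = r * x ∧ cs.length x < cs.length y

/-- The Bruhat order in terms of chains in the Bruhat graph. -/
def ChainLE (cs : CoxeterSystem M W) : W → W → Prop := Relation.ReflTransGen (BruhatStep cs)

/-- A covering relation of the Bruhat order given by a reflection in the subgroup `D`. -/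
def CoverIn (cs : CoxeterSystem M W) (D : Subgroup W) (x y : W) : Prop :=
  ∃ r ∈ D, cs.IsReflection r ∧ y = r * x ∧ cs.length y = cs.length x + 1

variable {cs : CoxeterSystem M W}

lemma CoverIn.bruhatStep {D : Subgroup W} {x y : W} (h : CoverIn cs D x y) : BruhatStep cs x y := by
  obtain ⟨r, -, hr, hy, hl⟩ := h
  exact ⟨r, hr, hy, by omega⟩

lemma bruhatStep_mul_simple {x : W} {i : B} (h : cs.length x < cs.length (x * cs.simple i)) :
    BruhatStep cs x (x * cs.simple i) :=
  ⟨x * cs.simple i * x⁻¹, ⟨x, i, rfl⟩, by group, h⟩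

lemma bruhatStep_of_descent {x : W} {i : B} (h : cs.length (x * cs.simple i) < cs.length x) :
    BruhatStep cs (x * cs.simple i) x := by
  simpa using bruhatStep_mul_simple (cs := cs) (x := x * cs.simple i) (i := i) (by simpa using h)

lemma ChainLE.length_le {x y : W} (h : ChainLE cs x y) : cs.length x ≤ cs.length y := by
  induction h with
  | refl => exact le_rfl
  | tail _ h ih =>
    obtain ⟨r, -, -, hl⟩ := h
    omega

/-- An edge of the Bruhat graph is carried to an edge by a simple reflection on the right, unless
that reflection interchanges its two ends. -/
lemma BruhatStep.mul_simple {x y : W} (h : BruhatStep cs x y) (i : B) :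
    y = x * cs.simple i ∨ BruhatStep cs (x * cs.simple i) (y * cs.simple i) := by
  obtain ⟨r, hr, rfl, hl⟩ := h
  obtain ⟨b, hb, h0⟩ : ∃ b, IsRootOf cs r b ∧ 0 ≤ b := by
    obtain ⟨b, hb⟩ := hr.exists_isRootOf
    rcases hb.nonneg_or_nonpos with h0 | h0
    · exact ⟨b, hb, h0⟩
    · exact ⟨-b, hb.neg, neg_nonneg.2 h0⟩
  have hx := (hb.lt_length_mul_iff h0).1 hl
  -- The positive root `x⁻¹ b` stays positive under `s_i` unless it is the simple root itself, in
  -- which case `r x = x s_i`.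
  rcases (hb.inv_conj (x * cs.simple i)).nonneg_or_nonpos with h1 | h1
  · exact Or.inr ⟨r, hr, by rw [mul_assoc], by
      rw [mul_assoc]; exact hb.lt_length_mul h0 h1⟩
  · left
    rw [mul_inv_rev, cs.inv_simple, geomRep_mul_apply] at h1
    have h2 := (hb.inv_conj x).eq_simpleRoot hx h1
    have h3 := (hb.inv_conj x)
    rw [h2] at h3
    rw [← h3.unique (isRootOf_simple i)]
    group

/-- Multiply the chain by `s_i` edge by edge. At an edge that `s_i` interchanges, the translated
chain joins the original one. This and its mirror version are the lifting property. -/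
lemma ChainLE.mul_simple_left {x y : W} (h : ChainLE cs x y) (i : B) :
    ChainLE cs (x * cs.simple i) y ∨ ChainLE cs (x * cs.simple i) (y * cs.simple i) := by
  induction h using Relation.ReflTransGen.head_induction_on with
  | refl => exact Or.inr .refl
  | head h h' ih =>
    rcases h.mul_simple i with he | hs
    · exact Or.inl (he ▸ h')
    · exact ih.imp (fun h => .head hs h) (fun h => .head hs h)

lemma ChainLE.mul_simple_right {x y : W} (h : ChainLE cs x y) (i : B) :
    ChainLE cs x (y * cs.simple i) ∨ ChainLE cs (x * cs.simple i) (y * cs.simple i) := by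
  induction h with
  | refl => exact Or.inr .refl
  | tail h' h ih =>
    rcases h.mul_simple i with he | hs
    · left; rwa [he, cs.simple_mul_simple_cancel_right]
    · exact ih.imp (fun h => .tail h hs) (fun h => .tail h hs)

lemma ChainLE.le_mul_simple {x y : W} (h : ChainLE cs x y) {i : B}
    (hx : cs.length x < cs.length (x * cs.simple i)) : ChainLE cs x (y * cs.simple i) :=
  (h.mul_simple_right i).elim id fun h => .head (bruhatStep_mul_simple hx) h

lemma ChainLE.mul_simple_le_mul_simple {x y : W} (h : ChainLE cs x y) {i : B}
    (hx : cs.length (x * cs.simple i) < cs.length x) :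
    ChainLE cs (x * cs.simple i) (y * cs.simple i) :=
  (h.mul_simple_right i).elim (fun h => .head (bruhatStep_of_descent hx) h) id

lemma lt_length_mul_simple_or (cs : CoxeterSystem M W) (x : W) (i : B) :
    cs.length (x * cs.simple i) < cs.length x ∨ cs.length x < cs.length (x * cs.simple i) :=
  lt_or_gt_of_ne (cs.length_mul_simple_ne x i)

/-- If `x` is covered by `r x`, then `i` can be an ascent of `x` and a descent of `r x` only if
`r x = x s_i`. -/
lemma eq_mul_simple_of_cover {x y : W} (h : BruhatStep cs x y)
    (hl : cs.length y = cs.length x + 1) {i : B} (hx : cs.length x < cs.length (x * cs.simple i))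
    (hy : cs.length (y * cs.simple i) < cs.length y) : y = x * cs.simple i := by
  refine (h.mul_simple i).resolve_right ?_
  rintro ⟨r, -, -, h⟩
  omega

lemma CoverIn.mul_simple {D : Subgroup W} {x y : W} (h : CoverIn cs D x y) {i : B}
    (hx : cs.length (x * cs.simple i) < cs.length x)
    (hy : cs.length (y * cs.simple i) < cs.length y) :
    CoverIn cs D (x * cs.simple i) (y * cs.simple i) := by
  obtain ⟨r, hD, hr, he, hl⟩ := h
  have h1 := cs.isRightDescent_iff.1 hx
  have h2 := cs.isRightDescent_iff.1 hy
  exact ⟨r, hD, hr, by rw [he, mul_assoc], by omega⟩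

/-- Descending along a chain of covers in `D` whose upper end has the descent `i`. -/
lemma chain_mul_simple {D : Subgroup W} {x y : W} (h : Relation.ReflTransGen (CoverIn cs D) x y)
    {i : B} (hy : cs.length (y * cs.simple i) < cs.length y) :
    (cs.length (x * cs.simple i) < cs.length x →
      Relation.ReflTransGen (CoverIn cs D) (x * cs.simple i) (y * cs.simple i)) ∧
    (cs.length x < cs.length (x * cs.simple i) →
      Relation.ReflTransGen (CoverIn cs D) x (y * cs.simple i) ∧
        x * cs.simple i * x⁻¹ ∈ D) := by
  -- Work down from `y`. At a cover from an ascent of `i` to a descent, the covering reflection is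
  -- the one attached to `s_i`, so the latter is in `D`; conjugation by the covering reflections
  -- keeps it in `D` for lower elements, where it supplies the extra cover needed when `i` becomes a
  -- descent again.
  induction h using Relation.ReflTransGen.head_induction_on with
  | refl => exact ⟨fun _ => .refl, fun h => absurd hy (not_lt.2 h.le)⟩
  | @head x x' h h' ih =>
    obtain ⟨ih1, ih2⟩ := ih
    obtain ⟨r, hD, hr, he, hl⟩ := h
    have h : CoverIn cs D x x' := ⟨r, hD, hr, he, hl⟩
    constructor
    · intro hx
      rcases lt_length_mul_simple_or cs x' i with hx' | hx'
      · exact .head (h.mul_simple hx hx') (ih1 hx')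
      · obtain ⟨h1, h2⟩ := ih2 hx'
        have h3 : x * cs.simple i * x⁻¹ ∈ D := by
          have := D.mul_mem (D.mul_mem (D.inv_mem hD) h2) hD
          rw [he] at this
          convert this using 1
          group
        refine .head ⟨x * cs.simple i * x⁻¹, h3, ⟨x, i, rfl⟩, ?_, ?_⟩ (.head h h1)
        · simp [mul_assoc]
        · exact (cs.isRightDescent_iff.1 hx).symm
    · intro hx
      rcases lt_length_mul_simple_or cs x' i with hx' | hx'
      · have he' := eq_mul_simple_of_cover h.bruhatStep hl hx hx'
        refine ⟨?_, ?_⟩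
        · have := ih1 hx'
          rwa [he', cs.simple_mul_simple_cancel_right] at this
        · rw [← he', he]; simpa using hD
      · obtain ⟨h1, h2⟩ := ih2 hx'
        refine ⟨.head h h1, ?_⟩
        have := D.mul_mem (D.mul_mem (D.inv_mem hD) h2) hD
        rw [he] at this
        convert this using 1
        group

/-- If a saturated chain from `u` to `y` lies in the coset `D u` of a subgroup `D`, then so does
the whole Bruhat interval between `u` and `y`. -/
theorem mul_inv_mem_of_interval {D : Subgroup W} {u y : W}
    (h : Relation.ReflTransGen (CoverIn cs D) u y) {z : W} (huz : ChainLE cs u z)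
    (hzy : ChainLE cs z y) : z * u⁻¹ ∈ D := by
  induction hn : cs.length y using Nat.strong_induction_on generalizing u y z with
  | _ n ih =>
    subst hn
    by_cases hy1 : y = 1
    · have h1 := hzy.length_le
      have h2 := huz.length_le
      rw [hy1, cs.length_one, Nat.le_zero] at h1
      rw [h1, Nat.le_zero] at h2
      rw [cs.length_eq_zero_iff.1 h1, cs.length_eq_zero_iff.1 h2]
      simp
    obtain ⟨i, hy⟩ := cs.exists_rightDescent_of_ne_one hy1
    have hcancel : ∀ a b : W, a * cs.simple i * (b * cs.simple i)⁻¹ = a * b⁻¹ := by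
      intro a b; group
    -- Replace `y` by `y s_i`, and `u`, `z` by the lower of their two `s_i`-translates: lifting
    -- keeps the inequalities, and the chain lemma keeps the hypothesis.
    obtain ⟨c1, c2⟩ := chain_mul_simple h hy
    rcases lt_length_mul_simple_or cs u i with hu | hu
    · rcases lt_length_mul_simple_or cs z i with hz | hz
      · have := ih _ hy (c1 hu) (huz.mul_simple_le_mul_simple hu)
          (hzy.mul_simple_le_mul_simple hz) rfl
        rwa [hcancel] at this
      -- Here both `z` and `u` lie between `u s_i` and `y s_i`; comparing the two memberships
      -- eliminates `u s_i`.
      · have h1 : ChainLE cs (u * cs.simple i) u := .single (bruhatStep_of_descent hu)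
        have h2 := hzy.le_mul_simple hz
        have h3 := ih _ hy (c1 hu) (h1.trans huz) h2 rfl
        have h4 := ih _ hy (c1 hu) h1 (huz.trans h2) rfl
        have := D.mul_mem h3 (D.inv_mem h4)
        convert this using 1
        group
    · obtain ⟨c3, c4⟩ := c2 hu
      rcases lt_length_mul_simple_or cs z i with hz | hz
      · have h1 := ih _ hy c3 (huz.le_mul_simple hu) (hzy.mul_simple_le_mul_simple hz) rfl
        have := D.mul_mem h1 c4
        convert this using 1
        simp [mul_assoc]
      · exact ih _ hy c3 huz (hzy.le_mul_simple hz) rfl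

end BruhatChains

/-! ### Subword order versus chains -/

section BruhatSubwords

variable {B W : Type*} [Group W] [Fintype B] [DecidableEq B] {M : CoxeterMatrix B}
  {cs : CoxeterSystem M W}

lemma BruhatLE.refl (x : W) : BruhatLE cs x x := fun ω hω he => ⟨ω, List.Sublist.refl ω, hω, he⟩

lemma BruhatLE.trans {x y z : W} (h : BruhatLE cs x y) (h' : BruhatLE cs y z) :
    BruhatLE cs x z := by
  intro ω hω he
  obtain ⟨ω₁, hs₁, hr₁, he₁⟩ := h' ω hω he
  obtain ⟨ω₂, hs₂, hr₂, he₂⟩ := h ω₁ hr₁ he₁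
  exact ⟨ω₂, hs₂.trans hs₁, hr₂, he₂⟩

lemma chainLE_of_sublist {ω' ω : List B} (h : List.Sublist ω' ω) (hω : cs.IsReduced ω) :
    ChainLE cs (cs.wordProd ω') (cs.wordProd ω) := by
  induction ω using List.reverseRecOn generalizing ω' with
  | nil => rw [List.sublist_nil.1 h]; exact .refl
  | append_singleton ω i ih =>
    have hred : cs.IsReduced ω := by simpa using hω.take ω.length
    have hup : cs.length (cs.wordProd ω) < cs.length (cs.wordProd ω * cs.simple i) := by
      have h1 := hω.eq
      rw [cs.wordProd_append, cs.wordProd_singleton, List.length_append] at h1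
      rw [h1, hred.eq]
      simp
    have hstep := bruhatStep_mul_simple hup
    rw [cs.wordProd_append, cs.wordProd_singleton]
    obtain ⟨ω₁, ω₂, rfl, h1, h2⟩ := List.sublist_append_iff.1 h
    rcases List.sublist_singleton.1 h2 with rfl | rfl
    · rw [List.append_nil]
      exact (ih h1 hred).tail hstep
    · rw [cs.wordProd_append, cs.wordProd_singleton]
      exact ((ih h1 hred).mul_simple_left i).elim (fun h => h.tail hstep) id

lemma BruhatLE.chainLE {x y : W} (h : BruhatLE cs x y) : ChainLE cs x y := by
  obtain ⟨ω, hω, rfl⟩ := cs.exists_isReduced y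
  obtain ⟨ω', hs, -, rfl⟩ := h ω hω rfl
  exact chainLE_of_sublist hs hω

/-- Strong exchange deletes one letter from any reduced word of `r x`. Because this is a cover, the
remaining word has exactly the length of `x` and is reduced. -/
lemma bruhatLE_of_cover {r x : W} (hr : cs.IsReflection r)
    (hl : cs.length (r * x) = cs.length x + 1) : BruhatLE cs x (r * x) := by
  intro ω hω he
  obtain ⟨b, hb, h0⟩ : ∃ b, IsRootOf cs r b ∧ 0 ≤ b := by
    obtain ⟨b, hb⟩ := hr.exists_isRootOf
    rcases hb.nonneg_or_nonpos with h0 | h0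
    · exact ⟨b, hb, h0⟩
    · exact ⟨-b, hb.neg, neg_nonneg.2 h0⟩
  have hx := (hb.lt_length_mul_iff h0).1 (show cs.length x < cs.length (r * x) by omega)
  obtain ⟨k, hk, hk'⟩ := hb.exists_eraseIdx h0 ω (by
    rw [he, hb.inv_mul]; exact neg_nonpos.2 hx)
  rw [he, ← mul_assoc, hr.mul_self, one_mul] at hk'
  refine ⟨ω.eraseIdx k, List.eraseIdx_sublist ω k, ?_, hk'.symm⟩
  have h1 := hω.eq
  rw [CoxeterSystem.IsReduced, ← hk', List.length_eraseIdx_of_lt hk, ← h1, he]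
  omega

end BruhatSubwords

/-! ### Reduction to a membership statement about reflections -/

section Dagger

variable {B W : Type*} [Group W] [Fintype B] [DecidableEq B] {M : CoxeterMatrix B}
  {cs : CoxeterSystem M W} {n : ℕ} {r : ℕ → W} {w : W} {i : B}

lemma reflProd_succ_mul (r : ℕ → W) (t : ℕ) (x : W) :
    reflProd r (t + 1) * x = r (t + 1) * (reflProd r t * x) := by
  rw [reflProd, mul_assoc]

lemma PropertyDagger.length_eq (h : PropertyDagger cs n r w i) {t : ℕ} (ht : t + 1 ≤ n) :
    cs.length (reflProd r (t + 1) * (w * cs.simple i)) =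
      cs.length (reflProd r t * (w * cs.simple i)) + 1 := by
  simpa only [mul_assoc, Nat.add_sub_cancel] using h.length_step (t + 1) (by omega) ht

lemma PropertyDagger.covers (h : PropertyDagger cs n r w i) {t : ℕ} (ht : t ≤ n) :
    Relation.ReflTransGen (CoverIn cs (Subgroup.closure (r '' Set.Icc 1 n)))
      (w * cs.simple i) (reflProd r t * (w * cs.simple i)) := by
  induction t with
  | zero => simpa [reflProd] using Relation.ReflTransGen.refl
  | succ t ih =>
    refine (ih (by omega)).tail ⟨r (t + 1), Subgroup.subset_closure ⟨t + 1, ?_, rfl⟩,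
      h.isReflection _ ht, reflProd_succ_mul r t _, h.length_eq ht⟩
    exact ⟨by omega, ht⟩

/-- If `i` first became a descent at step `t + 1`, the cover there would be right multiplication by
`s_i`, which is the equality excluded by (†). -/
lemma PropertyDagger.ascent (h : PropertyDagger cs n r w i) {t : ℕ} (ht : t ≤ n) :
    cs.length (reflProd r t * (w * cs.simple i)) < cs.length (reflProd r t * w) := by
  have he : ∀ x, x * (w * cs.simple i) * cs.simple i = x * w := by intro x; simp [← mul_assoc]
  induction t with
  | zero => simpa [reflProd] using h.descent
  | succ t ih =>
    rcases lt_length_mul_simple_or cs (reflProd r (t + 1) * (w * cs.simple i)) i with hd | hd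
    · exfalso
      have h1 := eq_mul_simple_of_cover (x := reflProd r t * (w * cs.simple i)) (i := i)
        ⟨r (t + 1), h.isReflection _ ht, reflProd_succ_mul r t _, by
          rw [h.length_eq ht]; omega⟩
        (h.length_eq ht) (by rw [he]; exact ih (by omega)) hd
      rw [he, ← mul_assoc] at h1
      exact h.ne_step (t + 1) (by omega) ht h1
    · rwa [he] at hd

/-- Since `i` is an ascent all along the chain from `w s_i`, the chain multiplied by `s_i` again
consists of covers. -/
lemma PropertyDagger.bruhatLE (h : PropertyDagger cs n r w i) {t : ℕ} (ht : t ≤ n) :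
    BruhatLE cs w (reflProd r t * w) := by
  have hl : ∀ t ≤ n, cs.length (reflProd r t * w) =
      cs.length (reflProd r t * (w * cs.simple i)) + 1 := by
    intro t ht
    have h1 := h.ascent ht
    have h2 := cs.length_mul_simple (reflProd r t * w) i
    rw [← mul_assoc] at h1 ⊢
    omega
  induction t with
  | zero => simpa [reflProd] using BruhatLE.refl w
  | succ t ih =>
    refine (ih (by omega)).trans ?_
    rw [reflProd_succ_mul]
    refine bruhatLE_of_cover (h.isReflection _ ht) ?_
    rw [← reflProd_succ_mul, hl _ ht, hl t (by omega), h.length_eq ht]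

/-- If the conclusion fails, the wall separating `w` and `w s_i` belongs to the group generated by
the reflections in the given walls. -/
lemma PropertyDagger.mem_closure_of_bruhatLE (h : PropertyDagger cs n r w i)
    (hle : BruhatLE cs w (reflProd r n * w * cs.simple i)) :
    w * cs.simple i * w⁻¹ ∈ Subgroup.closure (r '' Set.Icc 1 n) := by
  have h1 := mul_inv_mem_of_interval (h.covers le_rfl)
    (.single (bruhatStep_of_descent h.descent)) (by rw [← mul_assoc]; exact hle.chainLE)
  convert h1 using 1
  simp [mul_assoc]

lemma PropertyDagger.mem_boundary (h : PropertyDagger cs n r w i)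
    (hmem : w * cs.simple i * w⁻¹ ∉ Subgroup.closure (r '' Set.Icc 1 n)) :
    reflProd r n * w * cs.simple i ∈ boundary cs (annex cs w) := by
  refine ⟨fun hle => hmem (h.mem_closure_of_bruhatLE hle), i, fun hn => hn ?_⟩
  rw [cs.simple_mul_simple_cancel_right]
  exact h.bruhatLE le_rfl

end Dagger

/-! ### Dominant functionals and common simplices of walls -/

section TitsCone

variable {B W : Type*} [Group W] [Fintype B] [DecidableEq B] {M : CoxeterMatrix B}
  {cs : CoxeterSystem M W}

lemma dual_nonneg {f : Module.Dual ℝ (B → ℝ)} (hf : ∀ i, 0 ≤ f (simpleRoot i)) {v : B → ℝ}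
    (hv : 0 ≤ v) : 0 ≤ f v := by
  rw [eq_sum_simpleRoot v, map_sum]
  exact Finset.sum_nonneg fun i _ => by
    rw [map_smul]
    exact smul_nonneg (hv i) (hf i)

lemma dual_ext {f g : Module.Dual ℝ (B → ℝ)} (h : ∀ i, f (simpleRoot i) = g (simpleRoot i)) :
    f = g := by
  ext v
  simpa [simpleRoot] using h v

/-- The stabilizer of a dominant functional is a standard parabolic subgroup. -/
theorem mem_parabolic_of_fixes_dominant {f : Module.Dual ℝ (B → ℝ)}
    (hf : ∀ i, 0 ≤ f (simpleRoot i)) {g : W} (hg : ∀ v, f (geomRep cs g v) = f v) :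
    g ∈ parabolic cs {i | f (simpleRoot i) = 0} := by
  induction hn : cs.length g using Nat.strong_induction_on generalizing g with
  | _ n ih =>
    subst hn
    by_cases hg1 : g = 1
    · rw [hg1]; exact one_mem _
    obtain ⟨i, hi⟩ := cs.exists_rightDescent_of_ne_one hg1
    -- At a descent `i`, `g` makes the simple root nonpositive, so `f`, being dominant and
    -- `g`-invariant, must vanish on it.
    have h1 := dual_nonneg hf (neg_nonneg.2 (geomRep_simpleRoot_nonpos cs g i hi))
    rw [map_neg, hg] at h1
    have h0 : f (simpleRoot i) = 0 := le_antisymm (neg_nonneg.1 h1) (hf i)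
    have h2 := ih _ hi (g := g * cs.simple i) (fun v => by
      rw [geomRep_mul_apply, hg, geomRep_simple, reflect_apply, map_sub, map_smul, h0, smul_zero,
        sub_zero]) rfl
    have h3 : cs.simple i ∈ parabolic cs {i | f (simpleRoot i) = 0} :=
      Subgroup.subset_closure ⟨i, h0, rfl⟩
    simpa using mul_mem h2 h3

lemma smul_coset_eq {p x : W} {H : Subgroup W} (h : x⁻¹ * p * x ∈ H) :
    p • (x • (H : Set W)) = x • (H : Set W) := by
  have h1 : (x⁻¹ * p * x) • (H : Set W) = H := smul_coe_set h
  conv_rhs => rw [← h1]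
  rw [smul_smul, smul_smul]
  congr 1
  group

lemma not_parallel_of_mem_parabolic {p q x : W} {J : Set B} (hJ : J ≠ Set.univ)
    (hp : x⁻¹ * p * x ∈ parabolic cs J) (hq : x⁻¹ * q * x ∈ parabolic cs J) :
    ¬ Parallel cs p q := fun h =>
  (Set.disjoint_left.1 h : ∀ ⦃σ⦄, σ ∈ wall cs p → σ ∉ wall cs q)
    ⟨⟨x, J, hJ, rfl⟩, smul_coset_eq hp⟩ ⟨⟨x, J, hJ, rfl⟩, smul_coset_eq hq⟩

/-- Two reflections fixing a common nonzero dominant functional (up to translation by `x`) have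
walls with a common simplex. -/
theorem not_parallel_of_fixes_dominant {f : Module.Dual ℝ (B → ℝ)}
    (hf : ∀ i, 0 ≤ f (simpleRoot i)) (hf0 : f ≠ 0) {p q x : W}
    (hp : ∀ v, f (geomRep cs (x⁻¹ * p * x) v) = f v)
    (hq : ∀ v, f (geomRep cs (x⁻¹ * q * x) v) = f v) : ¬ Parallel cs p q := by
  refine not_parallel_of_mem_parabolic (J := {i | f (simpleRoot i) = 0}) (x := x) (fun h => hf0 ?_)
    (mem_parabolic_of_fixes_dominant hf hp) (mem_parabolic_of_fixes_dominant hf hq)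
  refine dual_ext fun i => ?_
  have : i ∈ {i | f (simpleRoot i) = 0} := by rw [h]; trivial
  simpa using this

/-- The positive roots on which the functional `f` is negative. -/
def negativeRoots (cs : CoxeterSystem M W) (f : Module.Dual ℝ (B → ℝ)) : Set (B → ℝ) :=
  {b | (∃ r, IsRootOf cs r b) ∧ 0 ≤ b ∧ f b < 0}

/-- A functional negative on finitely many positive roots is in the Tits cone. -/
theorem exists_dominant_translate {f : Module.Dual ℝ (B → ℝ)} (hfin : (negativeRoots cs f).Finite) :
    ∃ x : W, ∀ i, 0 ≤ f (geomRep cs x (simpleRoot i)) := by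
  induction hn : (negativeRoots cs f).ncard using Nat.strong_induction_on generalizing f with
  | _ n ih =>
    subst hn
    by_cases hdom : ∀ i, 0 ≤ f (simpleRoot i)
    · exact ⟨1, by simpa using hdom⟩
    push Not at hdom
    obtain ⟨i, hi⟩ := hdom
    -- Composing with `s_i` removes the simple root from the negative positive roots, since `s_i`
    -- permutes the remaining positive roots.
    set g : Module.Dual ℝ (B → ℝ) := f ∘ₗ geomRep cs (cs.simple i) with hg
    have hinj : Function.Injective (geomRep cs (cs.simple i)) :=
      Function.LeftInverse.injective (geomRep_inv_apply_self cs (cs.simple i))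
    have hmem : simpleRoot i ∈ negativeRoots cs f :=
      ⟨⟨_, isRootOf_simple i⟩, simpleRoot_nonneg i, hi⟩
    have hsub : geomRep cs (cs.simple i) '' negativeRoots cs g ⊆
        negativeRoots cs f \ {simpleRoot i} := by
      rintro _ ⟨b, ⟨⟨r, hr⟩, h0, hb⟩, rfl⟩
      have hconj := hr.conj (cs.simple i)
      have hne : b ≠ simpleRoot i := by
        rintro rfl
        rw [hg, LinearMap.comp_apply, geomRep_simple_self, map_neg] at hb
        linarith
      refine ⟨⟨⟨_, hconj⟩, ?_, hb⟩, fun he => ?_⟩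
      · exact hconj.nonneg_or_nonpos.resolve_right fun h => hne (hr.eq_simpleRoot h0 h)
      · have h1 : b = -simpleRoot i := by
          apply hinj
          rw [Set.mem_singleton_iff.1 he, map_neg, geomRep_simple_self, neg_neg]
        rw [h1] at h0
        exact (isRootOf_simple (cs := cs) i).not_nonneg_and_nonpos (simpleRoot_nonneg i)
          (neg_nonneg.1 h0)
    have hgfin : (negativeRoots cs g).Finite :=
      Set.Finite.of_finite_image (hfin.subset (hsub.trans Set.sdiff_subset)) hinj.injOn
    have hlt : (negativeRoots cs g).ncard < (negativeRoots cs f).ncard := by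
      rw [← Set.ncard_image_of_injective _ hinj]
      exact Set.ncard_lt_ncard ((Set.ssubset_iff_of_subset (hsub.trans Set.sdiff_subset)).2
        ⟨_, hmem, fun h => (hsub h).2 rfl⟩) hfin
    obtain ⟨x, hx⟩ := ih _ hlt hgfin rfl
    exact ⟨cs.simple i * x, fun j => by simpa [hg, geomRep_mul_apply] using hx j⟩

/-- The sum of the coordinates. -/
noncomputable def height : Module.Dual ℝ (B → ℝ) := ∑ i, LinearMap.proj i

lemma height_apply (v : B → ℝ) : height v = ∑ i, v i := by simp [height]

lemma height_nonneg {v : B → ℝ} (hv : 0 ≤ v) : 0 ≤ height v := by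
  rw [height_apply]
  exact Finset.sum_nonneg fun i _ => hv i

lemma eq_zero_of_height_eq_zero {v : B → ℝ} (hv : 0 ≤ v) (h : height v = 0) : v = 0 := by
  rw [height_apply, Finset.sum_eq_zero_iff_of_nonneg fun i _ => hv i] at h
  ext i
  exact h i (Finset.mem_univ i)

/-- The positive roots made nonpositive by a given element are finite in number. -/
lemma finite_inversions (w : W) :
    {b : B → ℝ | (∃ r, IsRootOf cs r b) ∧ 0 ≤ b ∧ geomRep cs w b ≤ 0}.Finite := by
  induction w using cs.simple_induction_right with
  | one =>
    convert Set.finite_empty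
    ext b
    simp only [Set.mem_ofPred_eq, map_one, Module.End.one_apply, Set.mem_empty_iff_false, iff_false]
    rintro ⟨⟨r, hr⟩, h0, h1⟩
    exact hr.not_nonneg_and_nonpos h0 h1
  | mul_simple_right w i ih =>
    refine ((ih.image (geomRep cs (cs.simple i))).insert (simpleRoot i)).subset ?_
    rintro b ⟨⟨r, hr⟩, h0, hb⟩
    rw [geomRep_mul_apply] at hb
    have hconj := hr.conj (cs.simple i)
    rcases hconj.nonneg_or_nonpos with h | h
    · right
      refine ⟨_, ⟨⟨_, hconj⟩, h, hb⟩, ?_⟩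
      rw [← geomRep_mul_apply]
      simp
    · left
      exact hr.eq_simpleRoot h0 h

/-- An element is determined by the images of the simple roots, so finitely many roots would make
the group finite. -/
lemma infinite_positiveRoots [Infinite W] :
    {b : B → ℝ | (∃ r, IsRootOf cs r b) ∧ 0 ≤ b}.Infinite := by
  intro hfin
  have hroots : {b : B → ℝ | ∃ r, IsRootOf cs r b}.Finite := by
    refine (hfin.union hfin.neg).subset ?_
    rintro b ⟨r, hr⟩
    rcases hr.nonneg_or_nonpos with h | h
    · exact Or.inl ⟨⟨r, hr⟩, h⟩
    · exact Or.inr ⟨⟨r, hr.neg⟩, neg_nonneg.2 h⟩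
  have := hroots.to_subtype
  let F : W → B → {b : B → ℝ | ∃ r, IsRootOf cs r b} := fun w i =>
    ⟨geomRep cs w (simpleRoot i), _, w, i, rfl, rfl⟩
  have hF : Function.Injective F := by
    intro x y hxy
    apply geomRep_injective cs
    refine LinearMap.ext fun v => ?_
    rw [eq_sum_simpleRoot v, map_sum, map_sum]
    refine Finset.sum_congr rfl fun i _ => ?_
    rw [map_smul, map_smul]
    congr 1
    exact congrArg Subtype.val (congrFun hxy i)
  exact not_finite_iff_infinite.2 ‹Infinite W› (Finite.of_injective F hF)

/-- In an infinite Coxeter group, the walls of two reflections generating a finite group have a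
common simplex. -/
theorem not_parallel_of_isOfFinOrder [Infinite W] {p q : W} (hp : cs.IsReflection p)
    (hq : cs.IsReflection q) (h : IsOfFinOrder (p * q)) : ¬ Parallel cs p q := by
  have : Finite (Subgroup.zpowers (p * q)) := (finite_zpowers.2 h).to_subtype
  have := Fintype.ofFinite (Subgroup.zpowers (p * q))
  -- Average the height over the finite dihedral group, written as rotations `c` and reflections `c
  -- p`. The result is invariant under `p` and `q`, and positive on every positive root that no
  -- group element makes negative, hence on all but finitely many.
  let f : Module.Dual ℝ (B → ℝ) := ∑ c : Subgroup.zpowers (p * q),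
    (height ∘ₗ geomRep cs (c : W) + height ∘ₗ geomRep cs ((c : W) * p))
  have hf : ∀ v, f v = ∑ c : Subgroup.zpowers (p * q), height (geomRep cs (c : W) v) +
      ∑ c : Subgroup.zpowers (p * q), height (geomRep cs ((c : W) * p) v) := by
    intro v
    simp [f, Finset.sum_add_distrib]
  have hfp : ∀ v, f (geomRep cs p v) = f v := by
    intro v
    rw [hf, hf, add_comm]
    simp only [← geomRep_mul_apply, mul_assoc, hp.mul_self, mul_one]
  have hfq : ∀ v, f (geomRep cs q v) = f v := by
    intro v
    have hpq : (p * q)⁻¹ * p = q := by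
      rw [mul_inv_rev, mul_assoc, inv_mul_cancel, mul_one, hq.inv]
    let g : Subgroup.zpowers (p * q) := ⟨p * q, Subgroup.mem_zpowers _⟩
    rw [hf, hf, add_comm]
    congr 1
    · rw [← Equiv.sum_comp (Equiv.mulRight g) fun c : Subgroup.zpowers (p * q) =>
        height (geomRep cs (c : W) v)]
      simp only [Equiv.coe_mulRight, Subgroup.coe_mul, mul_assoc, ← geomRep_mul_apply, g]
    · rw [← Equiv.sum_comp (Equiv.mulRight g⁻¹) fun c : Subgroup.zpowers (p * q) =>
        height (geomRep cs ((c : W) * p) v)]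
      simp only [Equiv.coe_mulRight, Subgroup.coe_mul, mul_assoc, ← geomRep_mul_apply]
      simp only [g, Subgroup.coe_inv, hpq]
  have hneg : ∀ b, ((∃ r, IsRootOf cs r b) ∧ 0 ≤ b) → (∀ c : Subgroup.zpowers (p * q),
      0 ≤ geomRep cs (c : W) b ∧ 0 ≤ geomRep cs ((c : W) * p) b) → 0 < f b := by
    rintro b ⟨⟨r, hr⟩, h0⟩ hb
    rw [hf]
    refine add_pos_of_pos_of_nonneg ?_ (Finset.sum_nonneg fun c _ => height_nonneg (hb c).2)
    refine Finset.sum_pos' (fun c _ => height_nonneg (hb c).1) ⟨1, Finset.mem_univ _, ?_⟩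
    refine lt_of_le_of_ne (height_nonneg (hb 1).1) fun he => ?_
    exact (hr.conj 1).ne_zero (eq_zero_of_height_eq_zero (hb 1).1 he.symm)
  have hU : (⋃ c : Subgroup.zpowers (p * q),
      ({b : B → ℝ | (∃ r, IsRootOf cs r b) ∧ 0 ≤ b ∧ geomRep cs (c : W) b ≤ 0} ∪
      {b : B → ℝ | (∃ r, IsRootOf cs r b) ∧ 0 ≤ b ∧ geomRep cs ((c : W) * p) b ≤ 0})).Finite :=
    Set.finite_iUnion fun c => (finite_inversions _).union (finite_inversions _)
  have hcompl : ∀ b, ((∃ r, IsRootOf cs r b) ∧ 0 ≤ b) → b ∉ (⋃ c : Subgroup.zpowers (p * q),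
      ({b : B → ℝ | (∃ r, IsRootOf cs r b) ∧ 0 ≤ b ∧ geomRep cs (c : W) b ≤ 0} ∪
      {b : B → ℝ | (∃ r, IsRootOf cs r b) ∧ 0 ≤ b ∧ geomRep cs ((c : W) * p) b ≤ 0})) →
      0 < f b := by
    intro b hb hnot
    simp only [Set.mem_iUnion, Set.mem_union, not_exists, not_or] at hnot
    obtain ⟨⟨r, hr⟩, h0⟩ := hb
    refine hneg b ⟨⟨r, hr⟩, h0⟩ fun c => ⟨?_, ?_⟩
    · exact (hr.conj (c : W)).nonneg_or_nonpos.resolve_right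
        fun h => (hnot c).1 ⟨⟨r, hr⟩, h0, h⟩
    · exact (hr.conj ((c : W) * p)).nonneg_or_nonpos.resolve_right
        fun h => (hnot c).2 ⟨⟨r, hr⟩, h0, h⟩
  have hfin : (negativeRoots cs f).Finite := by
    refine hU.subset fun b hb => ?_
    by_contra hnot
    exact absurd (hcompl b ⟨hb.1, hb.2.1⟩ hnot) (not_lt.2 hb.2.2.le)
  have hf0 : f ≠ 0 := by
    obtain ⟨b, hb, hbU⟩ := (infinite_positiveRoots (cs := cs)).exists_notMem_finite hU
    intro h0
    have := hcompl b hb hbU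
    rw [h0] at this
    simp at this
  obtain ⟨x, hx⟩ := exists_dominant_translate hfin
  have hinv : ∀ r, (∀ v, f (geomRep cs r v) = f v) → ∀ v, (f ∘ₗ geomRep cs x)
      (geomRep cs (x⁻¹ * r * x) v) = (f ∘ₗ geomRep cs x) v := by
    intro r hr v
    rw [LinearMap.comp_apply, LinearMap.comp_apply, mul_assoc, geomRep_mul_apply,
      geomRep_apply_inv_self, geomRep_mul_apply, hr]
  refine not_parallel_of_fixes_dominant (f := f ∘ₗ geomRep cs x) hx (fun h0 => hf0 ?_)
    (hinv p hfp) (hinv q hfq)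
  ext1 v
  have := congrArg (fun g : Module.Dual ℝ (B → ℝ) => g (geomRep cs x⁻¹ (Pi.single v 1))) h0
  ext
  simpa using this

end TitsCone

/-! ### The radical and products of reflections with isotropic difference -/

section Radical

variable {B W : Type*} [Group W] [Fintype B] [DecidableEq B] {M : CoxeterMatrix B}
  {cs : CoxeterSystem M W}

/-- The radical of the standard form. -/
noncomputable def radical (M : CoxeterMatrix B) : Submodule ℝ (B → ℝ) := LinearMap.ker (form M)

lemma form_eq_zero_of_mem_radical {v : B → ℝ} (hv : v ∈ radical M) (w : B → ℝ) :
    form M v w = 0 := by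
  rw [radical, LinearMap.mem_ker] at hv
  rw [hv, LinearMap.zero_apply]

lemma form_eq_zero_of_mem_radical' {v : B → ℝ} (hv : v ∈ radical M) (w : B → ℝ) :
    form M w v = 0 := by
  rw [form_comm, form_eq_zero_of_mem_radical hv]

lemma mem_radical_of_forall_simpleRoot {v : B → ℝ} (h : ∀ i, form M v (simpleRoot i) = 0) :
    v ∈ radical M := by
  rw [radical, LinearMap.mem_ker]
  exact dual_ext fun i => by rw [h, LinearMap.zero_apply]

lemma geomRep_eq_of_mem_radical {v : B → ℝ} (hv : v ∈ radical M) (x : W) :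
    geomRep cs x v = v := by
  induction x using cs.simple_induction_left with
  | one => simp
  | mul_simple_left x i ih =>
    rw [geomRep_mul_apply, ih, geomRep_simple, reflect_apply, form_eq_zero_of_mem_radical hv]
    simp

/-- If the generators move all vectors only by vectors in `U`, then so does the group they
generate. -/
lemma sub_mem_of_mem_closure {S : Set W} {U : Submodule ℝ (B → ℝ)}
    (hS : ∀ s ∈ S, ∀ v, geomRep cs s v - v ∈ U) {x : W} (hx : x ∈ Subgroup.closure S) (v : B → ℝ) :
    geomRep cs x v - v ∈ U := by
  induction hx using Subgroup.closure_induction generalizing v with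
  | mem s hs => exact hS s hs v
  | one => simp
  | mul x y _ _ hx hy =>
    rw [geomRep_mul_apply, ← sub_add_sub_cancel _ (geomRep cs y v)]
    exact U.add_mem (hx _) (hy _)
  | inv x _ hx =>
    have := U.neg_mem (hx (geomRep cs x⁻¹ v))
    rwa [geomRep_apply_inv_self, neg_sub] at this

lemma IsRootOf.sub_mem {r : W} {b : B → ℝ} (h : IsRootOf cs r b) {U : Submodule ℝ (B → ℝ)}
    (hb : b ∈ U) (v : B → ℝ) : geomRep cs r v - v ∈ U := by
  rw [h.geomRep_apply, sub_sub_cancel_left]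
  exact U.neg_mem (U.smul_mem _ hb)

lemma IsRootOf.mem_of_sub_mem {r : W} {b : B → ℝ} (h : IsRootOf cs r b)
    {U : Submodule ℝ (B → ℝ)} (hU : geomRep cs r b - b ∈ U) : b ∈ U := by
  rw [h.geomRep_self] at hU
  have h1 := U.smul_mem (-2⁻¹ : ℝ) hU
  convert h1 using 1
  module

/-- Powers of the product of two reflections in roots `a` and `a - ν`, with `ν` isotropic and
orthogonal to `a`. -/
lemma geomRep_pow_of_isotropic {p q : W} {a ν : B → ℝ} (hp : IsRootOf cs p a)
    (hq : IsRootOf cs q (a - ν)) (haν : form M a ν = 0) (hνν : form M ν ν = 0) (k : ℕ)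
    (v : B → ℝ) :
    geomRep cs ((p * q) ^ k) v = v - (2 * k * form M v ν) • a +
      (2 * (k * form M v a - k ^ 2 * form M v ν)) • ν := by
  have hνa : form M ν a = 0 := by rw [form_comm, haν]
  induction k generalizing v with
  | zero => simp
  | succ k ih =>
    rw [pow_succ, geomRep_mul_apply, ih, geomRep_mul_apply, hq.geomRep_apply, hp.geomRep_apply]
    simp only [map_sub, map_smul, LinearMap.sub_apply, LinearMap.smul_apply, smul_eq_mul,
      hp.form_self, haν, hνν, hνa]
    push_cast
    module

/-- A power of the product of two reflections in roots `a` and `a - ν` commutes with its conjugate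
by a simple reflection only if `ν` is orthogonal to the simple root. -/
lemma form_simpleRoot_eq_zero_of_commute {p q : W} {a ν : B → ℝ} (hp : IsRootOf cs p a)
    (hq : IsRootOf cs q (a - ν)) (haν : form M a ν = 0) (hνν : form M ν ν = 0) {k : ℕ}
    (hk : k ≠ 0) {i : B}
    (hcomm : Commute ((p * q) ^ k) (cs.simple i * (p * q) ^ k * (cs.simple i)⁻¹)) :
    form M ν (simpleRoot i) = 0 := by
  have hk' : (k : ℝ) ≠ 0 := by exact_mod_cast hk
  have hνa : form M ν a = 0 := by rw [form_comm, haν]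
  by_contra hne
  set τ := (p * q) ^ k with hτ
  set s := cs.simple i with hs
  set τ' := s * τ * s⁻¹ with hτ'
  have hpow : ∀ v, geomRep cs τ v = v - (2 * k * form M v ν) • a +
      (2 * (k * form M v a - k ^ 2 * form M v ν)) • ν := geomRep_pow_of_isotropic hp hq haν hνν k
  -- The image of `(τ - 1)²` lies in the line of `ν`, and is that line if `ν` is not orthogonal to
  -- the simple root. Whatever commutes with `τ` must then preserve it.
  have hsq : ∀ v, geomRep cs τ (geomRep cs τ v - v) - (geomRep cs τ v - v) =
      (-(4 * k ^ 2 * form M v ν)) • ν := by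
    intro v
    rw [hpow (geomRep cs τ v - v), hpow v]
    simp only [map_sub, map_add, map_smul, LinearMap.sub_apply, LinearMap.add_apply,
      LinearMap.smul_apply, smul_eq_mul, hp.form_self, haν, hνν, hνa]
    module
  have hcommv : ∀ v, geomRep cs τ (geomRep cs τ' v) = geomRep cs τ' (geomRep cs τ v) := by
    intro v
    rw [← geomRep_mul_apply, ← geomRep_mul_apply, hcomm.eq]
  -- the line spanned by `ν` is invariant under `τ'`
  obtain ⟨κ, hκ⟩ : ∃ κ : ℝ, geomRep cs τ' ν = κ • ν := by
    have h1 := hsq (geomRep cs τ' (simpleRoot i))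
    have h2 := congrArg (geomRep cs τ') (hsq (simpleRoot i))
    have h0 : form M (simpleRoot i) ν ≠ 0 := by rwa [form_comm]
    rw [map_sub, map_sub, map_smul] at h2
    rw [hcommv, ← map_sub, hcommv, map_sub, map_sub] at h1
    rw [map_sub] at h2
    rw [h2] at h1
    refine ⟨form M (geomRep cs τ' (simpleRoot i)) ν / form M (simpleRoot i) ν, ?_⟩
    have h3 : geomRep cs τ' ν = (-(4 * (k : ℝ) ^ 2 * form M (simpleRoot i) ν))⁻¹ •
        ((-(4 * (k : ℝ) ^ 2 * form M (simpleRoot i) ν)) • geomRep cs τ' ν) := by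
      rw [smul_smul, inv_mul_cancel₀, one_smul]
      exact neg_ne_zero.2 (mul_ne_zero (by positivity) h0)
    rw [h3, h1, smul_smul]
    congr 1
    field_simp
  -- Undoing the conjugation, `s ν` is an eigenvector of `τ`. Pairing with `ν` forces `κ = 1`;
  -- pairing with `a` then forces `(s ν, ν) = -2 (ν, α_i)²` to vanish.
  have h4 : κ • geomRep cs s ν = geomRep cs τ (geomRep cs s ν) := by
    have h5 : geomRep cs s (geomRep cs τ' ν) = geomRep cs τ (geomRep cs s ν) := by
      rw [← geomRep_mul_apply, ← geomRep_mul_apply]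
      congr 1
      rw [hτ', hs, cs.inv_simple, mul_assoc, cs.simple_mul_simple_cancel_left]
    rw [← h5, hκ, map_smul]
  rw [hpow (geomRep cs s ν)] at h4
  have e1 := congrArg (fun v => form M v ν) h4
  have e2 := congrArg (fun v => form M v a) h4
  simp only [map_sub, map_add, map_smul, LinearMap.sub_apply, LinearMap.add_apply,
    LinearMap.smul_apply, smul_eq_mul, hp.form_self, haν, hνν, hνa, mul_zero, sub_zero,
    add_zero, mul_one] at e1 e2
  have hb : form M (geomRep cs s ν) ν = -(2 * form M ν (simpleRoot i) ^ 2) := by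
    rw [hs, geomRep_simple, reflect_apply]
    simp only [map_sub, map_smul, LinearMap.sub_apply, LinearMap.smul_apply, smul_eq_mul, hνν,
      form_comm M (simpleRoot i) ν]
    ring
  have hb0 : form M (geomRep cs s ν) ν ≠ 0 := by
    rw [hb]
    exact neg_ne_zero.2 (mul_ne_zero two_ne_zero (pow_ne_zero 2 hne))
  have hκ1 : κ = 1 := by
    have : (κ - 1) * form M (geomRep cs s ν) ν = 0 := by linear_combination e1
    exact sub_eq_zero.1 ((mul_eq_zero.1 this).resolve_right hb0)
  rw [hκ1] at e2
  have : 2 * (k : ℝ) * form M (geomRep cs s ν) ν = 0 := by linear_combination e2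
  exact mul_ne_zero (mul_ne_zero two_ne_zero hk') hb0 this

end Radical

/-! ### Parallel walls have roots congruent modulo the radical -/

section Hyperbolic

variable {B W : Type*} [Group W] [Fintype B] [DecidableEq B] {M : CoxeterMatrix B}
  {cs : CoxeterSystem M W} {p q : W} {a b : B → ℝ}

lemma eq_zero_of_mem_span_of_orthogonal (ha : form M a a = 1) (hb : form M b b = 1)
    (hab : form M a b ^ 2 ≠ 1) {v : B → ℝ} (hv : v ∈ Submodule.span ℝ {a, b})
    (hva : form M v a = 0) (hvb : form M v b = 0) : v = 0 := by
  obtain ⟨x, y, rfl⟩ := Submodule.mem_span_pair.1 hv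
  simp only [map_add, map_smul, LinearMap.add_apply, LinearMap.smul_apply, smul_eq_mul, ha, hb,
    form_comm M b a] at hva hvb
  have hd : 1 - form M a b ^ 2 ≠ 0 := fun h => hab (by linarith)
  have hx : x = 0 := by
    have : x * (1 - form M a b ^ 2) = 0 := by linear_combination hva - form M a b * hvb
    exact (mul_eq_zero.1 this).resolve_right hd
  have hy : y = 0 := by
    have : y * (1 - form M a b ^ 2) = 0 := by linear_combination hvb - form M a b * hva
    exact (mul_eq_zero.1 this).resolve_right hd
  simp [hx, hy]

/-- If every simple root is in the plane of the roots `a`, `b` or orthogonal to it, and not all of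
them are in it, then the walls are not parallel. -/
lemma not_parallel_of_invariant_plane (ha : IsRootOf cs p a) (hb : IsRootOf cs q b)
    (hab : form M a b ^ 2 ≠ 1)
    (h : ∀ i, simpleRoot i ∈ Submodule.span ℝ {a, b} ∨
      form M (simpleRoot i) a = 0 ∧ form M (simpleRoot i) b = 0)
    (hex : ∃ i, simpleRoot i ∉ Submodule.span ℝ {a, b}) : ¬ Parallel cs p q := by
  classical
  set P := Submodule.span ℝ {a, b} with hP
  -- The sum of the coordinates at simple roots outside the plane. It kills the plane: the outer
  -- part of a vector of `P` lies in `P` and is orthogonal to `P`, hence is zero.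
  let f : Module.Dual ℝ (B → ℝ) :=
    ∑ i ∈ Finset.univ.filter (fun i => simpleRoot i ∉ P), LinearMap.proj i
  have hf : ∀ v, f v = ∑ i ∈ Finset.univ.filter (fun i => simpleRoot i ∉ P), v i := by
    intro v; simp [f]
  have hfi : ∀ i, f (simpleRoot i) = if simpleRoot i ∉ P then 1 else 0 := by
    intro i
    rw [hf]
    have happ : ∀ j, simpleRoot (B := B) i j = if j = i then 1 else 0 := fun j =>
      Pi.single_apply i 1 j
    simp only [happ, Finset.sum_ite_eq', Finset.mem_filter, Finset.mem_univ, true_and]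
  have hzero : ∀ v ∈ P, f v = 0 := by
    intro v hv
    have hdec : v = ∑ i ∈ Finset.univ.filter (fun i => simpleRoot i ∉ P), v i • simpleRoot i +
        ∑ i ∈ Finset.univ.filter (fun i => ¬ simpleRoot i ∉ P), v i • simpleRoot i := by
      rw [Finset.sum_filter_add_sum_filter_not]
      exact eq_sum_simpleRoot v
    have hin : ∑ i ∈ Finset.univ.filter (fun i => ¬ simpleRoot i ∉ P), v i • simpleRoot i ∈ P :=
      Submodule.sum_mem _ fun i hi => P.smul_mem _ (not_not.1 (Finset.mem_filter.1 hi).2)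
    have hout : ∑ i ∈ Finset.univ.filter (fun i => simpleRoot i ∉ P), v i • simpleRoot i = 0 := by
      refine eq_zero_of_mem_span_of_orthogonal ha.form_self hb.form_self hab ?_ ?_ ?_
      · rw [← hP, ← P.add_mem_iff_left hin, ← hdec]
        exact hv
      · rw [map_sum, LinearMap.sum_apply]
        refine Finset.sum_eq_zero fun i hi => ?_
        rw [map_smul, LinearMap.smul_apply,
          ((h i).resolve_left (Finset.mem_filter.1 hi).2).1, smul_zero]
      · rw [map_sum, LinearMap.sum_apply]
        refine Finset.sum_eq_zero fun i hi => ?_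
        rw [map_smul, LinearMap.smul_apply,
          ((h i).resolve_left (Finset.mem_filter.1 hi).2).2, smul_zero]
    rw [hdec, hout, zero_add, map_sum]
    refine Finset.sum_eq_zero fun i hi => ?_
    rw [map_smul, hfi, if_neg (Finset.mem_filter.1 hi).2, smul_zero]
  have hfa := hzero a (Submodule.subset_span (by simp))
  have hfb := hzero b (Submodule.subset_span (by simp))
  refine not_parallel_of_fixes_dominant (f := f) (x := 1) (fun i => ?_) (fun h0 => ?_) ?_ ?_
  · rw [hfi]; split_ifs <;> norm_num
  · obtain ⟨i, hi⟩ := hex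
    have := hfi i
    rw [h0, if_pos hi] at this
    simp at this
  · intro v
    simp [ha.geomRep_apply, hfa]
  · intro v
    simp [hb.geomRep_apply, hfb]

lemma geomRep_sub_mem_span (ha : IsRootOf cs p a) (hb : IsRootOf cs q b) (k : ℕ) (v : B → ℝ) :
    geomRep cs ((p * q) ^ k) v - v ∈ Submodule.span ℝ {a, b} := by
  refine sub_mem_of_mem_closure (S := {p, q}) ?_ (pow_mem (mul_mem
    (Subgroup.subset_closure (by simp)) (Subgroup.subset_closure (by simp))) k) v
  rintro s (rfl | rfl) v
  · exact ha.sub_mem (Submodule.subset_span (by simp)) v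
  · exact hb.sub_mem (Submodule.subset_span (by simp)) v

lemma geomRep_pow_eq_of_orthogonal (ha : IsRootOf cs p a) (hb : IsRootOf cs q b) (k : ℕ)
    {l : B → ℝ} (hla : form M l a = 0) (hlb : form M l b = 0) :
    geomRep cs ((p * q) ^ k) l = l := by
  rw [map_pow]
  refine pow_apply_eq_self _ ?_ k
  rw [geomRep_mul_apply, hb.geomRep_apply, hlb, mul_zero, zero_smul, sub_zero, ha.geomRep_apply,
    hla, mul_zero, zero_smul, sub_zero]

/-- A nontrivial rotation has no nonzero fixed vector in its plane. -/
lemma eq_zero_of_fixed (ha : IsRootOf cs p a) (hb : IsRootOf cs q b) (hab : form M a b ^ 2 ≠ 1)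
    (hfin : ¬ IsOfFinOrder (p * q)) {k : ℕ} (hk : k ≠ 0) {v : B → ℝ}
    (hv : v ∈ Submodule.span ℝ {a, b}) (hfix : geomRep cs ((p * q) ^ k) v = v) : v = 0 := by
  set τ := (p * q) ^ k with hτ
  -- Both reflections invert the rotation `τ`, so they preserve its fixed space. A nonzero fixed
  -- vector would thus force first one root and then the other to be fixed, making `τ` trivial.
  have hpτ : p * τ * p⁻¹ = τ⁻¹ := by
    rw [hτ, ← conj_pow, ← inv_pow]
    congr 1
    rw [← mul_assoc, ha.isReflection.mul_self, mul_inv_rev, ha.isReflection.inv,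
      hb.isReflection.inv, one_mul]
  have hqτ : q * τ * q⁻¹ = τ⁻¹ := by
    rw [hτ, ← conj_pow, ← inv_pow]
    congr 1
    rw [mul_inv_rev, ha.isReflection.inv, hb.isReflection.inv, mul_assoc, mul_assoc,
      hb.isReflection.mul_self, mul_one]
  have hstab : ∀ r, r * τ * r⁻¹ = τ⁻¹ → ∀ x, geomRep cs τ x = x →
      geomRep cs τ (geomRep cs r x) = geomRep cs r x := by
    intro r hr x hx
    have h1 : τ * r = r * τ⁻¹ := by
      have h2 : r * τ⁻¹ * r⁻¹ = τ := by rw [← conj_inv, hr, inv_inv]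
      exact (mul_inv_eq_iff_eq_mul.1 h2).symm
    rw [← geomRep_mul_apply, h1, geomRep_mul_apply]
    congr 1
    conv_lhs => rw [← hx]
    exact geomRep_inv_apply_self cs τ x
  -- a fixed vector not orthogonal to a root forces that root to be fixed
  have hroot : ∀ {r c x}, IsRootOf cs r c → r * τ * r⁻¹ = τ⁻¹ → geomRep cs τ x = x →
      form M x c ≠ 0 → geomRep cs τ c = c := by
    intro r c x hr hrτ hx hne
    have h1 := hstab r hrτ x hx
    rw [hr.geomRep_apply, map_sub, hx, map_smul, sub_right_inj] at h1
    exact smul_right_injective _ (mul_ne_zero two_ne_zero hne) h1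
  have hboth : geomRep cs τ a = a → geomRep cs τ b = b → False := by
    intro h1 h2
    refine hfin (isOfFinOrder_iff_pow_eq_one.2 ⟨k, Nat.pos_of_ne_zero hk, ?_⟩)
    apply geomRep_injective cs
    refine LinearMap.ext fun v => ?_
    obtain ⟨x, y, l, rfl, hla, hlb⟩ :=
      exists_orthogonal_decomposition M ha.form_self hb.form_self hab v
    rw [map_one, Module.End.one_apply, map_add, map_add, map_smul, map_smul,
      geomRep_pow_eq_of_orthogonal ha hb k hla hlb, ← hτ, h1, h2]
  have hc : form M a b = 0 → False := by
    intro hc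
    have h1 : p * q * p⁻¹ = q := by
      have h2 := hb.conj p
      rw [ha.geomRep_apply, form_comm, hc, mul_zero, zero_smul, sub_zero] at h2
      exact h2.unique hb
    refine hfin (isOfFinOrder_iff_pow_eq_one.2 ⟨2, two_pos, ?_⟩)
    rw [ha.isReflection.inv] at h1
    rw [pow_two, ← mul_assoc, h1, hb.isReflection.mul_self]
  by_cases hva : form M v a = 0
  · by_cases hvb : form M v b = 0
    · exact eq_zero_of_mem_span_of_orthogonal ha.form_self hb.form_self hab hv hva hvb
    · have h1 := hroot hb hqτ hfix hvb
      by_cases h2 : form M b a = 0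
      · exact (hc (by rw [form_comm, h2])).elim
      · exact (hboth (hroot ha hpτ h1 h2) h1).elim
  · have h1 := hroot ha hpτ hfix hva
    by_cases h2 : form M a b = 0
    · exact (hc h2).elim
    · exact (hboth h1 (hroot hb hqτ h1 h2)).elim

/-- The plane of a nontrivial rotation is the set of displacements of its vectors. -/
lemma exists_geomRep_sub_eq (ha : IsRootOf cs p a) (hb : IsRootOf cs q b)
    (hab : form M a b ^ 2 ≠ 1) (hfin : ¬ IsOfFinOrder (p * q)) {k : ℕ} (hk : k ≠ 0)
    {z : B → ℝ} (hz : z ∈ Submodule.span ℝ {a, b}) :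
    ∃ x, geomRep cs ((p * q) ^ k) x - x = z := by
  set P := Submodule.span ℝ {a, b} with hP
  let E : Module.End ℝ (B → ℝ) := geomRep cs ((p * q) ^ k) - 1
  have hE : ∀ x ∈ P, E x ∈ P := fun x _ => geomRep_sub_mem_span ha hb k x
  have hinj : Function.Injective (E.restrict hE) := by
    rw [injective_iff_map_eq_zero]
    rintro ⟨x, hx⟩ h0
    have h1 : E x = 0 := congrArg Subtype.val h0
    exact Subtype.ext (eq_zero_of_fixed ha hb hab hfin hk hx (sub_eq_zero.1 h1))
  obtain ⟨⟨x, hx⟩, he⟩ := LinearMap.injective_iff_surjective.1 hinj ⟨z, hz⟩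
  exact ⟨x, congrArg Subtype.val he⟩

/-- In rank three the orthogonal space of a nondegenerate plane is a line. -/
lemma exists_orthogonal_line (hcard : Fintype.card B = 3) (ha : form M a a = 1)
    (hb : form M b b = 1) (hab : form M a b ^ 2 ≠ 1) :
    ∃ l : B → ℝ, l ≠ 0 ∧ form M l a = 0 ∧ form M l b = 0 ∧
      ∀ v, form M v a = 0 → form M v b = 0 → ∃ c : ℝ, v = c • l := by
  let F : (B → ℝ) →ₗ[ℝ] ℝ × ℝ := ((form M).flip a).prod ((form M).flip b)
  have hd : 1 - form M a b ^ 2 ≠ 0 := fun h => hab (by linarith)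
  have hsurj : LinearMap.range F = ⊤ := by
    rw [LinearMap.range_eq_top]
    rintro ⟨s, t⟩
    refine ⟨((s - form M a b * t) / (1 - form M a b ^ 2)) • a +
      ((t - form M a b * s) / (1 - form M a b ^ 2)) • b, ?_⟩
    ext
    · simp [F, ha, form_comm M b a]
      field_simp
      ring
    · simp [F, hb]
      field_simp
      ring
  have hrank := LinearMap.finrank_range_add_finrank_ker F
  rw [hsurj, finrank_top, Module.finrank_prod, Module.finrank_self, Module.finrank_fintype_fun_eq_card,
    hcard] at hrank
  obtain ⟨⟨l, hl⟩, hl0, hspan⟩ := finrank_eq_one_iff'.1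
    (show Module.finrank ℝ (LinearMap.ker F) = 1 by omega)
  have hmem : ∀ v, v ∈ LinearMap.ker F ↔ form M v a = 0 ∧ form M v b = 0 := by
    intro v
    simp [F, LinearMap.mem_ker]
  refine ⟨l, fun h => hl0 (Subtype.ext h), ((hmem l).1 hl).1, ((hmem l).1 hl).2, ?_⟩
  intro v h1 h2
  obtain ⟨c, hc⟩ := hspan ⟨v, (hmem v).2 ⟨h1, h2⟩⟩
  exact ⟨c, (congrArg Subtype.val hc).symm⟩

/-- In rank three, if the powers of `p q` commute with their conjugates, and the plane of the roots
is nondegenerate, then the walls are not parallel. -/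
theorem not_parallel_of_nondegenerate (hcard : Fintype.card B = 3) (ha : IsRootOf cs p a)
    (hb : IsRootOf cs q b) (hab : form M a b ^ 2 ≠ 1) (hfin : ¬ IsOfFinOrder (p * q)) {k : ℕ}
    (hk : k ≠ 0)
    (hcomm : ∀ i, Commute ((p * q) ^ k) (cs.simple i * (p * q) ^ k * (cs.simple i)⁻¹)) :
    ¬ Parallel cs p q := by
  set P := Submodule.span ℝ {a, b} with hP
  obtain ⟨l, hl0, hla, hlb, hline⟩ :=
    exists_orthogonal_line hcard ha.form_self hb.form_self hab
  have haP : a ∈ P := Submodule.subset_span (by simp)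
  have hbP : b ∈ P := Submodule.subset_span (by simp)
  refine not_parallel_of_invariant_plane ha hb hab (fun i => ?_) ?_
  · set s := cs.simple i with hs
    set τ := (p * q) ^ k with hτ
    set σ := s * τ * s⁻¹ with hσ
    have hσ2 : σ ^ 2 = s * (p * q) ^ (k * 2) * s⁻¹ := by rw [hσ, conj_pow, pow_mul]
    have hcommv : ∀ v, geomRep cs τ (geomRep cs σ v) = geomRep cs σ (geomRep cs τ v) := by
      intro v
      rw [← geomRep_mul_apply, ← geomRep_mul_apply, (hcomm i).eq]
    -- Since `σ` commutes with `τ`, it preserves the fixed line of `l`, acting by a sign unless `l`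
    -- is radical and so fixed. The square removes the sign.
    have hσl : geomRep cs (σ ^ 2) l = l := by
      have hfixl : geomRep cs τ (geomRep cs σ l) = geomRep cs σ l := by
        rw [hcommv, geomRep_pow_eq_of_orthogonal ha hb k hla hlb]
      obtain ⟨x, y, m, hm, hma, hmb⟩ :=
        exists_orthogonal_decomposition M ha.form_self hb.form_self hab (geomRep cs σ l)
      have hm0 : x • a + y • b = 0 := by
        refine eq_zero_of_fixed ha hb hab hfin hk
          (P.add_mem (P.smul_mem _ haP) (P.smul_mem _ hbP)) ?_
        have h1 := hfixl
        rw [hm, map_add, geomRep_pow_eq_of_orthogonal ha hb k hma hmb] at h1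
        exact add_right_cancel h1
      rw [hm0, zero_add] at hm
      obtain ⟨c, hc⟩ := hline m hma hmb
      rw [hc] at hm
      by_cases hll : form M l l = 0
      · have hrad : l ∈ radical M := by
          refine mem_radical_of_forall_simpleRoot fun j => ?_
          obtain ⟨x, y, m, hm, hma, hmb⟩ :=
            exists_orthogonal_decomposition M ha.form_self hb.form_self hab (simpleRoot j)
          obtain ⟨c, hc⟩ := hline m hma hmb
          rw [hm, hc]
          simp [hla, hlb, hll]
        exact geomRep_eq_of_mem_radical hrad _
      · have h1 := form_geomRep cs σ l l
        rw [hm] at h1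
        simp only [map_smul, LinearMap.smul_apply, smul_eq_mul] at h1
        have h2 : c * c = 1 := by
          apply mul_right_cancel₀ hll
          linear_combination h1
        rw [pow_two, geomRep_mul_apply, hm, map_smul, hm, smul_smul, h2, one_smul]
    -- Write the plane part of `v` as a displacement `τ z - z` and interchange `σ² - 1` with `τ -
    -- 1`.
    have hP2 : ∀ v, geomRep cs (σ ^ 2) v - v ∈ P := by
      intro v
      obtain ⟨x, y, m, rfl, hma, hmb⟩ :=
        exists_orthogonal_decomposition M ha.form_self hb.form_self hab v
      obtain ⟨c, rfl⟩ := hline m hma hmb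
      obtain ⟨z, hz⟩ := exists_geomRep_sub_eq ha hb hab hfin hk
        (P.add_mem (P.smul_mem x haP) (P.smul_mem y hbP))
      have h1 : geomRep cs (σ ^ 2) (x • a + y • b + c • l) - (x • a + y • b + c • l) =
          geomRep cs τ (geomRep cs (σ ^ 2) z - z) - (geomRep cs (σ ^ 2) z - z) := by
        have hcomm2 : geomRep cs τ (geomRep cs (σ ^ 2) z) = geomRep cs (σ ^ 2) (geomRep cs τ z) := by
          rw [pow_two, geomRep_mul_apply cs σ σ, hcommv, hcommv, ← geomRep_mul_apply]
        rw [← hz, map_add, map_smul, hσl, add_sub_add_right_eq_sub, map_sub, map_sub, hcomm2,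
          sub_sub_sub_comm]
      rw [h1]
      exact geomRep_sub_mem_span ha hb k _
    -- The displacements of `σ² = s τ² s⁻¹` are the `s`-images of those of `τ²`, and the latter fill
    -- `P`.
    have hsP : ∀ z ∈ P, geomRep cs s z ∈ P := by
      intro z hz
      obtain ⟨x, hx⟩ := exists_geomRep_sub_eq ha hb hab hfin (mul_ne_zero hk two_ne_zero) hz
      have h1 := hP2 (geomRep cs s x)
      rw [hσ2, geomRep_mul_apply, geomRep_mul_apply, geomRep_inv_apply_self, ← map_sub, hx] at h1
      exact h1
    have hmem : ∀ z ∈ P, form M z (simpleRoot i) ≠ 0 → simpleRoot i ∈ P := by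
      intro z hz hne
      have h1 := P.sub_mem hz (hsP z hz)
      rw [hs, geomRep_simple, reflect_apply, sub_sub_cancel] at h1
      exact (P.smul_mem_iff (mul_ne_zero two_ne_zero hne)).1 h1
    by_cases h1 : form M a (simpleRoot i) = 0
    · by_cases h2 : form M b (simpleRoot i) = 0
      · right
        rw [form_comm, h1, form_comm, h2]
        exact ⟨rfl, rfl⟩
      · exact Or.inl (hmem b hbP h2)
    · exact Or.inl (hmem a haP h1)
  · by_contra! hall
    refine hl0 (eq_zero_of_mem_span_of_orthogonal ha.form_self hb.form_self hab ?_ hla hlb)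
    rw [eq_sum_simpleRoot l]
    exact Submodule.sum_mem _ fun i _ => P.smul_mem _ (hall i)

/-- In an affine group of rank three, parallel walls belong to roots that are congruent modulo the
radical. -/
theorem exists_isRootOf_sub_mem_radical (hcard : Fintype.card B = 3) (hW : IsAffine W)
    (ha : IsRootOf cs p a) (hq : cs.IsReflection q) (hpq : Parallel cs p q) :
    ∃ b, IsRootOf cs q b ∧ b - a ∈ radical M := by
  obtain ⟨hinf, A, hA, hAcomm, hAfin⟩ := hW
  have hfin : ¬ IsOfFinOrder (p * q) := fun h =>
    not_parallel_of_isOfFinOrder ha.isReflection hq h hpq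
  -- The index of `A` serves as the exponent: that power of `p q` lies in the normal abelian
  -- subgroup, hence commutes with its conjugates.
  have hk : A.index ≠ 0 := hAfin.index_ne_zero
  have hmemA : (p * q) ^ A.index ∈ A := A.pow_index_mem _
  have hcomm : ∀ i, Commute ((p * q) ^ A.index)
      (cs.simple i * (p * q) ^ A.index * (cs.simple i)⁻¹) := fun i =>
    hAcomm _ hmemA _ (hA.conj_mem _ hmemA _)
  obtain ⟨b, hb⟩ := hq.exists_isRootOf
  have hsq : form M a b ^ 2 = 1 := by
    by_contra hab
    exact not_parallel_of_nondegenerate hcard ha hb hab hfin hk hcomm hpq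
  obtain ⟨b, hb, hab⟩ : ∃ b, IsRootOf cs q b ∧ form M a b = 1 := by
    rcases sq_eq_one_iff.1 hsq with h | h
    · exact ⟨b, hb, h⟩
    · exact ⟨-b, hb.neg, by rw [map_neg, h, neg_neg]⟩
  refine ⟨b, hb, ?_⟩
  rw [← neg_sub, Submodule.neg_mem_iff]
  refine mem_radical_of_forall_simpleRoot fun i => ?_
  refine form_simpleRoot_eq_zero_of_commute ha (by rwa [sub_sub_cancel]) ?_ ?_ hk (hcomm i)
  · rw [map_sub, ha.form_self, hab, sub_self]
  · simp [ha.form_self, hb.form_self, hab, form_comm M b a]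

end Hyperbolic

/-! ### The ordered class of parallel walls -/

section ParallelClass

variable {B W : Type*} [Group W] [Fintype B] [DecidableEq B] {M : CoxeterMatrix B}
  {cs : CoxeterSystem M W} {p q : W} {a b : B → ℝ}

lemma form_eq_one_of_sub_mem_radical (ha : IsRootOf cs p a) (h : b - a ∈ radical M) :
    form M b a = 1 := by
  have h1 := form_eq_zero_of_mem_radical h a
  rw [map_sub, LinearMap.sub_apply, ha.form_self] at h1
  linarith

/-- Roots that are congruent modulo the radical are comparable. -/
lemma lt_or_eq_or_gt_of_sub_mem_radical (ha : IsRootOf cs p a) (hb : IsRootOf cs q b)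
    (h : b - a ∈ radical M) : a < b ∨ a = b ∨ b < a := by
  have hν : a - b ∈ radical M := by rw [← neg_sub]; exact Submodule.neg_mem _ h
  have hpow : ∀ k : ℕ, geomRep cs ((p * q) ^ k) a = a + (2 * k : ℝ) • (a - b) := by
    intro k
    rw [geomRep_pow_of_isotropic ha (by rwa [sub_sub_cancel])
      (form_eq_zero_of_mem_radical' hν _) (form_eq_zero_of_mem_radical hν _),
      form_eq_zero_of_mem_radical' hν, ha.form_self]
    module
  -- The roots `a + 2k (a - b)` would have coordinates of both signs for large `k` if `a - b` had.
  have hcmp : a ≤ b ∨ b ≤ a := by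
    by_contra! hcon
    obtain ⟨h1, h2⟩ := hcon
    rw [Pi.le_def] at h1 h2
    push Not at h1 h2
    obtain ⟨i, hi⟩ := h1
    obtain ⟨j, hj⟩ := h2
    obtain ⟨m, hm⟩ := exists_nat_gt (-a i / (a i - b i))
    obtain ⟨m', hm'⟩ := exists_nat_gt (a j / (b j - a j))
    rw [div_lt_iff₀ (by linarith)] at hm hm'
    have hk1 : (m : ℝ) ≤ (m + m' : ℕ) := by exact_mod_cast Nat.le_add_right m m'
    have hk2 : (m' : ℝ) ≤ (m + m' : ℕ) := by exact_mod_cast Nat.le_add_left m' m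
    have hroot := ha.conj ((p * q) ^ (m + m'))
    rw [hpow] at hroot
    have hm0 : (0 : ℝ) ≤ m := m.cast_nonneg
    have hm0' : (0 : ℝ) ≤ m' := m'.cast_nonneg
    rcases hroot.nonneg_or_nonpos with h | h
    · have := h j
      simp only [Pi.zero_apply, Pi.add_apply, Pi.smul_apply, Pi.sub_apply, smul_eq_mul] at this
      nlinarith
    · have := h i
      simp only [Pi.zero_apply, Pi.add_apply, Pi.smul_apply, Pi.sub_apply, smul_eq_mul] at this
      nlinarith
  rcases eq_or_ne a b with he | hne
  · exact Or.inr (Or.inl he)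
  · exact hcmp.imp (fun h => lt_of_le_of_ne h hne) fun h => Or.inr (lt_of_le_of_ne h hne.symm)

lemma inv_conj_mem_of_smul_coset_eq {x : W} {H : Subgroup W}
    (h : p • (x • (H : Set W)) = x • (H : Set W)) : x⁻¹ * p * x ∈ H := by
  have h1 : p * x ∈ x • (H : Set W) := by
    rw [← h]
    exact Set.smul_mem_smul_set ⟨1, H.one_mem, by simp⟩
  obtain ⟨y, hy, he⟩ := h1
  have he' : x * y = p * x := he
  rw [mul_assoc, ← he', inv_mul_cancel_left]
  exact hy

lemma apply_eq_zero_of_mem_span {J : Set B} {v : B → ℝ}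
    (hv : v ∈ Submodule.span ℝ (simpleRoot '' J)) {k : B} (hk : k ∉ J) : v k = 0 := by
  induction hv using Submodule.span_induction with
  | mem v hv =>
    obtain ⟨j, hj, rfl⟩ := hv
    exact Pi.single_eq_of_ne (by rintro rfl; exact hk hj) _
  | zero => rfl
  | add v w _ _ hv hw => rw [Pi.add_apply, hv, hw, add_zero]
  | smul c v _ hv => rw [Pi.smul_apply, hv, smul_zero]

/-- If the wall of a root contains a simplex of type `J`, then a translate of the root is supported
in `J`. -/
lemma IsRootOf.mem_span_of_fixes_simplex (ha : IsRootOf cs p a) {x : W} {J : Set B}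
    (h : p • (x • (parabolic cs J : Set W)) = x • (parabolic cs J : Set W)) :
    geomRep cs x⁻¹ a ∈ Submodule.span ℝ (simpleRoot '' J) := by
  have h1 := inv_conj_mem_of_smul_coset_eq h
  refine (ha.inv_conj x).mem_of_sub_mem (sub_mem_of_mem_closure ?_ h1 _)
  rintro _ ⟨j, hj, rfl⟩ v
  exact (isRootOf_simple j).sub_mem (Submodule.subset_span (Set.mem_image_of_mem _ hj)) v

lemma form_apply_simpleRoot (v : B → ℝ) (k : B) :
    form M v (simpleRoot k) = ∑ j, v j * form M (simpleRoot j) (simpleRoot k) := by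
  conv_lhs => rw [eq_sum_simpleRoot v]
  simp [map_sum, LinearMap.sum_apply]

/-- In rank three, a nonzero nonnegative radical vector with a vanishing coordinate `k` forces
`k` to be orthogonal to the other simple roots. -/
lemma form_apply_eq_coord_of_radical (hcard : Fintype.card B = 3) {ν : B → ℝ}
    (hν : ν ∈ radical M) (h0 : 0 ≤ ν) (hne : ν ≠ 0) {k : B} (hk : ν k = 0) (v : B → ℝ) :
    form M v (simpleRoot k) = v k := by
  -- All terms of the vanishing sum `(ν, α_k)` are nonpositive, since `ν k = 0`; so each vanishes.
  have hterm : ∀ j, ν j * form M (simpleRoot j) (simpleRoot k) = 0 := by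
    have hsum := form_eq_zero_of_mem_radical hν (simpleRoot k)
    rw [form_apply_simpleRoot, Finset.sum_eq_zero_iff_of_nonpos] at hsum
    · exact fun j => hsum j (Finset.mem_univ j)
    · intro j _
      by_cases hj : j = k
      · rw [hj, hk, zero_mul]
      · exact mul_nonpos_of_nonneg_of_nonpos (h0 j) (form_simpleRoot_nonpos M hj)
  -- With one more zero coordinate, `ν` would be a multiple of a single simple root, which is not
  -- isotropic.
  have hsupp : ∀ j, j ≠ k → ν j ≠ 0 := by
    intro j hjk hj
    obtain ⟨l, hl⟩ : ∃ l, ν l ≠ 0 := by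
      by_contra! hall
      exact hne (funext hall)
    have huniv : ({k, j, l} : Finset B) = Finset.univ := by
      apply Finset.eq_univ_of_card
      rw [hcard, Finset.card_eq_three]
      exact ⟨k, j, l, hjk.symm, fun h => hl (h ▸ hk), fun h => hl (h ▸ hj), rfl⟩
    have hval : ν = ν l • simpleRoot l := by
      ext i
      have hi : i ∈ ({k, j, l} : Finset B) := huniv ▸ Finset.mem_univ i
      simp only [Finset.mem_insert, Finset.mem_singleton] at hi
      by_cases hil : i = l
      · subst hil; simp [simpleRoot]
      · have : ν i = 0 := by
          rcases hi with rfl | rfl | rfl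
          · exact hk
          · exact hj
          · exact absurd rfl hil
        simp [simpleRoot, this, hil]
    have h1 := form_eq_zero_of_mem_radical hν (simpleRoot l)
    rw [hval, map_smul, LinearMap.smul_apply, form_simpleRoot_self, smul_eq_mul, mul_one] at h1
    exact hl h1
  rw [form_apply_simpleRoot, Finset.sum_eq_single k]
  · rw [form_simpleRoot_self, mul_one]
  · intro j _ hjk
    rw [(mul_eq_zero.1 (hterm j)).resolve_left (hsupp j hjk), mul_zero]
  · exact fun h => absurd (Finset.mem_univ k) h

/-- In rank three, if some parallel walls have roots in a class modulo the radical, then any two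
distinct roots in that class have parallel walls. -/
theorem parallel_of_sub_mem_radical (hcard : Fintype.card B = 3) {p₀ q₀ : W} {a₀ b₀ : B → ℝ}
    (ha₀ : IsRootOf cs p₀ a₀) (hb₀ : IsRootOf cs q₀ b₀) (hpar : Parallel cs p₀ q₀)
    (ha : IsRootOf cs p a) (hb : IsRootOf cs q b) (hne : a ≠ b)
    (haa : a - a₀ ∈ radical M) (hab : b - a₀ ∈ radical M) (hbb : b₀ - a₀ ∈ radical M) :
    Parallel cs p q := by
  refine Set.disjoint_left.2 ?_
  rintro _ ⟨⟨x, J, hJ, rfl⟩, hp⟩ ⟨-, hq⟩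
  obtain ⟨k, hk⟩ : ∃ k, k ∉ J := by
    by_contra! hall
    exact hJ (Set.eq_univ_of_forall hall)
  have h1 := apply_eq_zero_of_mem_span (ha.mem_span_of_fixes_simplex hp) hk
  have h2 := apply_eq_zero_of_mem_span (hb.mem_span_of_fixes_simplex hq) hk
  have hν : b - a ∈ radical M := by
    have := Submodule.sub_mem _ hab haa
    rwa [sub_sub_sub_cancel_right] at this
  have hνk : (b - a) k = 0 := by
    rw [← geomRep_eq_of_mem_radical (cs := cs) hν x⁻¹, map_sub, Pi.sub_apply, h1, h2, sub_zero]
  -- A common simplex forces `α_k` to be orthogonal to the other simple roots. Then the roots of the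
  -- class have no `k`-coordinate, and the `k`-th coordinate is a dominant functional fixed by `p₀`
  -- and `q₀`, so their walls meet as well.
  have hform : ∀ v, form M v (simpleRoot k) = v k := by
    rcases lt_or_eq_or_gt_of_sub_mem_radical ha hb hν with hlt | he | hlt
    · exact form_apply_eq_coord_of_radical hcard hν (sub_nonneg.2 hlt.le)
        (sub_ne_zero.2 hne.symm) hνk
    · exact absurd he hne
    · refine form_apply_eq_coord_of_radical hcard (ν := a - b) ?_ (sub_nonneg.2 hlt.le)
        (sub_ne_zero.2 hne) ?_
      · rw [← neg_sub]; exact Submodule.neg_mem _ hν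
      · rw [← neg_sub, Pi.neg_apply, hνk, neg_zero]
  have hinv : ∀ (g : W) (v : B → ℝ), v k = 0 → geomRep cs g v k = 0 := by
    intro g
    induction g using cs.simple_induction_left with
    | one => simp
    | mul_simple_left g i ih =>
      intro v hv
      rw [geomRep_mul_apply, geomRep_simple, reflect_apply, Pi.sub_apply, ih v hv, Pi.smul_apply]
      by_cases hik : i = k
      · rw [hik, hform, ih v hv]; simp
      · simp [simpleRoot, Ne.symm hik]
  have hrad : ∀ v ∈ radical M, v k = 0 := by
    intro v hv
    rw [← hform v, form_eq_zero_of_mem_radical hv]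
  have hak : a k = 0 := by
    have := hinv x _ h1
    rwa [geomRep_apply_inv_self] at this
  have hak₀ : a₀ k = 0 := by
    have := hrad _ haa
    rw [Pi.sub_apply, hak] at this
    linarith
  have hbk₀ : b₀ k = 0 := by
    have := hrad _ hbb
    rw [Pi.sub_apply, hak₀] at this
    linarith
  refine not_parallel_of_fixes_dominant (f := LinearMap.proj k) (x := 1) (fun i => ?_)
    (fun h0 => ?_) (fun v => ?_) (fun v => ?_) hpar
  · exact simpleRoot_nonneg i k
  · have := congrArg (fun f : Module.Dual ℝ (B → ℝ) => f (simpleRoot k)) h0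
    simp [simpleRoot] at this
  · simp [ha₀.geomRep_apply, hak₀]
  · simp [hb₀.geomRep_apply, hbk₀]

lemma not_parallel_self (hcard : Fintype.card B = 3) (hp : cs.IsReflection p) :
    ¬ Parallel cs p p := by
  obtain ⟨x, i, rfl⟩ := hp
  have : Nontrivial B := Fintype.one_lt_card_iff_nontrivial.1 (by omega)
  obtain ⟨j, hj⟩ := exists_ne i
  have hmem : x⁻¹ * (x * cs.simple i * x⁻¹) * x ∈ parabolic cs {i} := by
    have he : x⁻¹ * (x * cs.simple i * x⁻¹) * x = cs.simple i := by group
    rw [he]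
    exact Subgroup.subset_closure ⟨i, rfl, rfl⟩
  refine not_parallel_of_mem_parabolic (J := {i}) (fun h => hj ?_) hmem hmem
  have : j ∈ ({i} : Set B) := by rw [h]; trivial
  exact this

end ParallelClass

/-! ### Sides of walls in terms of roots -/

section Sides

variable {B W : Type*} [Group W] [Fintype B] [DecidableEq B] {M : CoxeterMatrix B}
  {cs : CoxeterSystem M W} {p q : W} {a b : B → ℝ}

lemma IsRootOf.not_nonneg_iff (ha : IsRootOf cs p a) (x : W) :
    ¬ 0 ≤ geomRep cs x⁻¹ a ↔ geomRep cs x⁻¹ a ≤ 0 :=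
  ⟨(ha.inv_conj x).nonneg_or_nonpos.resolve_left, fun h h' =>
    (ha.inv_conj x).not_nonneg_and_nonpos h' h⟩

lemma IsRootOf.sameSide_iff (ha : IsRootOf cs p a) (x y : W) :
    SameSide cs p x y ↔ (0 ≤ geomRep cs x⁻¹ a ↔ 0 ≤ geomRep cs y⁻¹ a) := by
  have hmem : ∀ x, x ∈ identityHalf cs p ↔ cs.length x < cs.length (p * x) := fun _ => Iff.rfl
  rw [SameSide, hmem, hmem]
  rcases ha.nonneg_or_nonpos with h | h
  · rw [ha.lt_length_mul_iff h, ha.lt_length_mul_iff h]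
  · rw [ha.neg.lt_length_mul_iff (neg_nonneg.2 h), ha.neg.lt_length_mul_iff (neg_nonneg.2 h),
      map_neg, map_neg, neg_nonneg, neg_nonneg, ← ha.not_nonneg_iff, ← ha.not_nonneg_iff,
      not_iff_not]

lemma _root_.CoxeterSystem.IsReflection.exists_borders (hp : cs.IsReflection p) :
    ∃ y, Borders cs p y := by
  obtain ⟨y, i, rfl⟩ := hp
  exact ⟨y, i, by group⟩

/-- The alcoves along the wall of a root lie on the positive side of every larger root of its
class modulo the radical. -/
lemma Borders.nonneg {y : W} (hy : Borders cs p y) (ha : IsRootOf cs p a) (hb : IsRootOf cs q b)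
    (hν : b - a ∈ radical M) (hab : a < b) : 0 ≤ geomRep cs y⁻¹ b := by
  by_contra hcon
  rw [hb.not_nonneg_iff] at hcon
  obtain ⟨i, hi⟩ := hy
  have h1 : geomRep cs y⁻¹ b = geomRep cs y⁻¹ a + (b - a) := by
    nth_rw 1 [← geomRep_eq_of_mem_radical (cs := cs) hν y⁻¹]
    rw [map_sub, add_sub_cancel]
  have h2 : ∀ j, j ≠ i → geomRep cs y⁻¹ a j = 0 := by
    intro j hj
    have h3 := ha.inv_conj y
    rw [mul_assoc, hi, inv_mul_cancel_left] at h3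
    rcases h3.eq_or_eq_neg (isRootOf_simple i) with h | h <;> simp [h, simpleRoot, hj]
  -- `y⁻¹ a` is `±` a simple root. If `y⁻¹ b` were nonpositive, the nonnegative radical vector `b -
  -- a` would be a multiple of that simple root, hence zero.
  have h3 : b - a = (b - a) i • simpleRoot i := by
    ext j
    by_cases hj : j = i
    · subst hj; simp [simpleRoot]
    · have h4 := hcon j
      rw [h1, Pi.add_apply, h2 j hj, zero_add] at h4
      have h5 := (sub_nonneg.2 hab.le : 0 ≤ b - a) j
      have h6 : (b - a) j = 0 := le_antisymm h4 h5
      rw [h6]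
      simp [simpleRoot, hj]
  have h4 := form_eq_zero_of_mem_radical hν (simpleRoot i)
  rw [h3, map_smul, LinearMap.smul_apply, form_simpleRoot_self, smul_eq_mul, mul_one] at h4
  rw [h4, zero_smul] at h3
  exact hab.ne (sub_eq_zero.1 h3).symm

lemma Borders.nonpos {y : W} (hy : Borders cs p y) (ha : IsRootOf cs p a) (hb : IsRootOf cs q b)
    (hν : b - a ∈ radical M) (hab : b < a) : geomRep cs y⁻¹ b ≤ 0 := by
  have h1 := hy.nonneg ha.neg hb.neg (by
    rw [neg_sub_neg, ← neg_sub]; exact Submodule.neg_mem _ hν) (neg_lt_neg hab)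
  rw [map_neg] at h1
  exact neg_nonneg.1 h1

/-- Walls with roots `a < c < b` in a class modulo the radical: the middle one separates. -/
lemma not_sameSide_of_lt {z y y' : W} {c : B → ℝ} (ha : IsRootOf cs p a) (hb : IsRootOf cs q b)
    (hc : IsRootOf cs z c) (hca : c - a ∈ radical M) (hcb : c - b ∈ radical M) (hac : a < c)
    (hcb' : c < b) (hy : Borders cs p y) (hy' : Borders cs q y') : ¬ SameSide cs z y y' := by
  rw [hc.sameSide_iff]
  have h1 := hy.nonneg ha hc hca hac
  have h2 := hy'.nonpos hb hc hcb hcb'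
  rw [← hc.not_nonneg_iff] at h2
  tauto

lemma SameSide.symm {z y y' : W} (h : SameSide cs z y y') : SameSide cs z y' y := Iff.symm h

end Sides

/-! ### Locating the wall between `w` and `w s_i` -/

section Strip

variable {B W : Type*} [Group W] [Fintype B] [DecidableEq B] {M : CoxeterMatrix B}
  {cs : CoxeterSystem M W} {n : ℕ} {r : ℕ → W} {w : W} {i : B}

/-- The case analysis for the wall separating `w` from `w s_i`, with the roots of the parallel
class oriented increasingly from `H_{r_0}` to `H_{r_1}`. -/
lemma PropertyDagger.false_of_isRootOf (hcard : Fintype.card B = 3)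
    (h : PropertyDagger cs n r w i) {b₀ b₁ b₂ c : B → ℝ} (h₀ : IsRootOf cs (r 0) b₀)
    (h₁ : IsRootOf cs (r 1) b₁) (h₂ : IsRootOf cs (r 2) b₂)
    (hc : IsRootOf cs (w * cs.simple i * w⁻¹) c) (e₀ : b₀ - b₁ ∈ radical M)
    (e₂ : b₂ - b₁ ∈ radical M) (ec : c - b₁ ∈ radical M) (h01 : b₀ < b₁) : False := by
  have hn := h.two_le
  have hp01 := h.parallel 0 1 one_pos (by omega)
  have hsub : ∀ {x y : B → ℝ}, x - b₁ ∈ radical M → y - b₁ ∈ radical M → x - y ∈ radical M := by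
    intro x y hx hy
    have := Submodule.sub_mem _ hx hy
    rwa [sub_sub_sub_cancel_right] at this
  have e₁ : b₁ - b₁ ∈ radical M := by rw [sub_self]; exact Submodule.zero_mem _
  -- no wall of the class separates adjacent ones
  have hadj : ∀ {p q z : W} {x y v : B → ℝ}, IsRootOf cs p x → IsRootOf cs q y → IsRootOf cs z v →
      x - b₁ ∈ radical M → y - b₁ ∈ radical M → v - b₁ ∈ radical M → x < v → v < y →
      ¬ Adjacent cs p q ∧ ¬ Adjacent cs q p := by
    intro p q z x y v hx hy hv ex ey ev hxv hvy
    have hpx : Parallel cs z p := parallel_of_sub_mem_radical hcard h₀ h₁ hp01 hv hx hxv.ne'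
      (hsub ev e₀) (hsub ex e₀) (hsub e₁ e₀)
    have hpy : Parallel cs z q := parallel_of_sub_mem_radical hcard h₀ h₁ hp01 hv hy hvy.ne
      (hsub ev e₀) (hsub ey e₀) (hsub e₁ e₀)
    refine ⟨fun hA => hA.2 z hv.isReflection hpx hpy fun s t hs ht => ?_,
      fun hA => hA.2 z hv.isReflection hpy hpx fun s t hs ht hst => ?_⟩
    · exact not_sameSide_of_lt hx hy hv (hsub ev ex) (hsub ev ey) hxv hvy hs ht
    · exact not_sameSide_of_lt hx hy hv (hsub ev ex) (hsub ev ey) hxv hvy ht hs hst.symm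
  have hw0 : geomRep cs w⁻¹ b₀ ≤ 0 := by
    obtain ⟨y, hy⟩ := h₁.isReflection.exists_borders
    have h1 := hy.nonpos h₁ h₀ e₀ h01
    have h2 := (h₀.sameSide_iff _ _).1 (h.between.1 y hy)
    rw [← h₀.not_nonneg_iff] at h1 ⊢
    tauto
  have hw1 : 0 ≤ geomRep cs w⁻¹ b₁ := by
    obtain ⟨y, hy⟩ := h₀.isReflection.exists_borders
    have h1 := hy.nonneg h₀ h₁ (hsub e₁ e₀) h01
    have h2 := (h₁.sameSide_iff _ _).1 (h.between.2 y hy)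
    tauto
  have hbw : Borders cs (w * cs.simple i * w⁻¹) w := ⟨i, by group⟩
  -- The wall of `c` borders `w`, so `c < b₀` and `b₁ < c` would put `w` outside the strip, while
  -- `b₀ < c < b₁` contradicts adjacency.
  rcases lt_or_eq_or_gt_of_sub_mem_radical hc h₀ (hsub e₀ ec) with hlt | he | hlt
  · exact (h₀.inv_conj w).not_nonneg_and_nonpos (hbw.nonneg hc h₀ (hsub e₀ ec) hlt) hw0
  · subst he
    have hr0 := hc.unique h₀
    have hu : r 0 * w = w * cs.simple i := by rw [← hr0]; group
    have hu0 : 0 ≤ geomRep cs (w * cs.simple i)⁻¹ c := by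
      rw [← hu, h₀.inv_mul]
      exact neg_nonneg.2 hw0
    -- As `w s_i = r_0 w` is shorter than `w`, the identity lies on the side of `w s_i`; hence all
    -- larger roots of the class are positive too.
    have hc0 : 0 ≤ c := by
      refine h₀.nonneg_or_nonpos.resolve_right fun hneg => ?_
      have h1 := (h₀.neg.lt_length_mul_iff (neg_nonneg.2 hneg) (x := w * cs.simple i)).1 (by
        rw [← hu, ← mul_assoc, h₀.isReflection.mul_self, one_mul, hu]
        exact h.descent)
      rw [map_neg] at h1
      exact (h₀.inv_conj _).not_nonneg_and_nonpos hu0 (neg_nonneg.1 h1)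
    have h12 : b₁ < b₂ := by
      rcases lt_or_eq_or_gt_of_sub_mem_radical h₁ h₂ e₂ with h12 | h12 | h12
      · exact h12
      · have hp := h.parallel 1 2 (by omega) hn
        rw [h₁.unique (h12 ▸ h₂)] at hp
        exact (not_parallel_self hcard h₂.isReflection hp).elim
      · exfalso
        rcases lt_or_eq_or_gt_of_sub_mem_radical h₀ h₂ (hsub e₂ e₀) with h02 | h02 | h02
        · exact (hadj h₀ h₁ h₂ e₀ e₁ e₂ h02 h12).1 (h.adjacent 0 (by omega))
        · have hp := h.parallel 0 2 (by omega) hn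
          rw [h₀.unique (h02 ▸ h₂)] at hp
          exact not_parallel_self hcard h₂.isReflection hp
        · exact (hadj h₂ h₁ h₀ e₂ e₁ e₀ h02 h01).2 (h.adjacent 1 (by omega))
    -- the image of `H_{r_0}` under `r_1`
    have hd : IsRootOf cs (r 1 * r 0 * (r 1)⁻¹) (b₁ + (b₁ - c)) := by
      convert (h₀.conj (r 1)).neg using 1
      rw [h₁.geomRep_apply, form_eq_one_of_sub_mem_radical h₁ e₀]
      module
    have ed : b₁ + (b₁ - c) - b₁ ∈ radical M := by
      rw [add_sub_cancel_left]; exact hsub e₁ e₀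
    have h1d : b₁ < b₁ + (b₁ - c) := lt_add_of_pos_right _ (sub_pos.2 h01)
    have hd2 : b₂ ≤ b₁ + (b₁ - c) := by
      rcases lt_or_eq_or_gt_of_sub_mem_radical hd h₂ (hsub e₂ ed) with h2 | h2 | h2
      · exact ((hadj h₁ h₂ hd e₁ e₂ ed h1d h2).1 (h.adjacent 1 (by omega))).elim
      · exact h2.ge
      · exact h2.le
    have hlen : cs.length (r 2 * (r 1 * (w * cs.simple i))) =
        cs.length (r 1 * (w * cs.simple i)) + 1 := by
      simpa only [reflProd, mul_one, mul_assoc] using h.length_eq (t := 1) hn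
    have hstep : 0 ≤ geomRep cs (r 1 * (w * cs.simple i))⁻¹ b₂ := by
      refine (h₂.lt_length_mul_iff (hc0.trans (h01.trans h12).le)).1 ?_
      rw [hlen]
      omega
    rw [mul_inv_rev, geomRep_mul_apply, h₁.isReflection.inv, h₁.geomRep_apply,
      form_eq_one_of_sub_mem_radical h₁ e₂] at hstep
    -- `-c` is the sum of `b₂ - 2 b₁ = r_1 b₂` and the nonnegative radical vector `(2 b₁ - c) - b₂`,
    -- which the group fixes.
    have hsplit : geomRep cs (w * cs.simple i)⁻¹ c = -(geomRep cs (w * cs.simple i)⁻¹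
        (b₂ - (2 * (1 : ℝ)) • b₁) + (b₁ + (b₁ - c) - b₂)) := by
      nth_rw 1 [← geomRep_eq_of_mem_radical (cs := cs) (hsub ed e₂) (w * cs.simple i)⁻¹]
      rw [← map_add, ← map_neg]
      congr 1
      module
    refine (h₀.inv_conj _).not_nonneg_and_nonpos hu0 ?_
    rw [hsplit]
    exact neg_nonpos.2 (add_nonneg hstep (sub_nonneg.2 hd2))
  · rcases lt_or_eq_or_gt_of_sub_mem_radical hc h₁ (hsub e₁ ec) with hlt1 | he | hlt1
    · exact (hadj h₀ h₁ hc e₀ e₁ ec hlt hlt1).1 (h.adjacent 0 (by omega))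
    · subst he
      refine h.ne_step 1 le_rfl (by omega) ?_
      simp only [reflProd, mul_one, Nat.sub_self, one_mul]
      rw [← hc.unique h₁]
      simp [mul_assoc]
    · exact (h₁.inv_conj w).not_nonneg_and_nonpos hw1 (hbw.nonpos hc h₁ (hsub e₁ ec) hlt1)

/-- The wall separating `w` from `w s_i` does not belong to the group generated by the reflections
in the walls `H_{r_1}, …, H_{r_n}`. -/
theorem PropertyDagger.notMem_closure (hcard : Fintype.card B = 3) (hW : IsAffine W)
    (h : PropertyDagger cs n r w i) :
    w * cs.simple i * w⁻¹ ∉ Subgroup.closure (r '' Set.Icc 1 n) := by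
  intro hmem
  have hn := h.two_le
  obtain ⟨b₁, h₁⟩ := (h.isReflection 1 (by omega)).exists_isRootOf
  have hclass : ∀ t ≤ n, ∃ b, IsRootOf cs (r t) b ∧ b - b₁ ∈ radical M := by
    intro t ht
    rcases lt_trichotomy t 1 with hlt | rfl | hlt
    · exact exists_isRootOf_sub_mem_radical hcard hW h₁ (h.isReflection t ht)
        (Disjoint.symm (h.parallel t 1 hlt (by omega)))
    · exact ⟨b₁, h₁, by rw [sub_self]; exact Submodule.zero_mem _⟩
    · exact exists_isRootOf_sub_mem_radical hcard hW h₁ (h.isReflection t ht)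
        (h.parallel 1 t hlt ht)
  obtain ⟨b₀, h₀, e₀⟩ := hclass 0 (by omega)
  obtain ⟨b₂, h₂, e₂⟩ := hclass 2 hn
  obtain ⟨c, hc, ec⟩ : ∃ c, IsRootOf cs (w * cs.simple i * w⁻¹) c ∧ c - b₁ ∈ radical M := by
    have hc : IsRootOf cs (w * cs.simple i * w⁻¹) (geomRep cs w (simpleRoot i)) :=
      ⟨w, i, rfl, rfl⟩
    -- Every generator of `D` moves vectors only within the span of `b₁` and the radical, so a root
    -- of a reflection in `D` lies there; being a unit vector, its coefficient at `b₁` is `±1`.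
    have hU : geomRep cs w (simpleRoot i) ∈ Submodule.span ℝ {b₁} ⊔ radical M := by
      refine hc.mem_of_sub_mem (sub_mem_of_mem_closure ?_ hmem _)
      rintro _ ⟨t, ht, rfl⟩ v
      obtain ⟨b, hb, eb⟩ := hclass t ht.2
      refine hb.sub_mem ?_ v
      rw [← add_sub_cancel b₁ b]
      exact Submodule.add_mem_sup (Submodule.mem_span_singleton_self b₁) eb
    obtain ⟨y, hy, ν, hν, he⟩ := Submodule.mem_sup.1 hU
    obtain ⟨t, rfl⟩ := Submodule.mem_span_singleton.1 hy
    have h1 := hc.form_self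
    rw [← he] at h1 hc
    simp only [map_add, map_smul, LinearMap.add_apply, LinearMap.smul_apply, smul_eq_mul,
      h₁.form_self, form_eq_zero_of_mem_radical hν, form_eq_zero_of_mem_radical' hν, mul_zero,
      add_zero, mul_one] at h1
    rcases mul_self_eq_one_iff.1 h1 with ht | ht
    · exact ⟨_, hc, by rwa [ht, one_smul, add_sub_cancel_left]⟩
    · refine ⟨_, hc.neg, ?_⟩
      rw [ht, neg_one_smul, neg_add, neg_neg, add_sub_cancel_left]
      exact Submodule.neg_mem _ hν
  have hneg : ∀ {x : B → ℝ}, x - b₁ ∈ radical M → -x - -b₁ ∈ radical M := by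
    intro x hx
    rw [neg_sub_neg, ← neg_sub]
    exact Submodule.neg_mem _ hx
  -- Negating all roots of the class reverses the order, so `b₀ < b₁` may be assumed.
  rcases lt_or_eq_or_gt_of_sub_mem_radical h₁ h₀ e₀ with hlt | he | hlt
  · exact h.false_of_isRootOf hcard h₀.neg h₁.neg h₂.neg hc.neg (hneg e₀) (hneg e₂) (hneg ec)
      (neg_lt_neg hlt)
  · have hp := h.parallel 0 1 one_pos (by omega)
    rw [h₁.unique (he ▸ h₀)] at hp
    exact not_parallel_self hcard h₀.isReflection hp
  · exact h.false_of_isRootOf hcard h₀ h₁ h₂ hc e₀ e₂ ec hlt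

end Strip

end CoxeterAnnex

theorem mainTheorem4 {W : Type*} [Group W] {M : CoxeterMatrix (Fin 3)} (cs : CoxeterSystem M W)
    (hW : CoxeterAnnex.IsAffine W) (n : ℕ) (r : ℕ → W) (w : W) (i : Fin 3)
    (h : CoxeterAnnex.PropertyDagger cs n r w i) :
    CoxeterAnnex.reflProd r n * w * cs.simple i ∈
      CoxeterAnnex.boundary cs (CoxeterAnnex.annex cs w) :=
  h.mem_boundary (h.notMem_closure (Fintype.card_fin 3) hW)
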